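/- **Conventions.** Let $S^1=\mathbb{R}/\mathbb{Z}$, let $\mathrm{Diff}_o(S^1)$ be the group of orientation preserving diffeomorphisms of $S^1$, and write $F'$, $F''$ for derivatives in the circle direction. Let $N=\mathbb{R}_{>0}\times \mathrm{Diff}_o(S^1)$ (the trumpet moduli space), a Fréchet manifold with tangent spaces $\mathbb{R}\times C^\infty(S^1)\ni(d\ell,dF)$. The group $\mathrm{Diff}_o(S^1)$ acts by $F_1\cdot(\ell,F)=(\ell,F\circ F_1^{-1})$ and $S^1$ acts by $t\cdot(\ell,F)=(\ell,F+t)$. Symplectic forms are smooth, closed and weakly nondegenerate. A Hill operator $L=\frac{d^2}{dx^2}+T$, $T\in C^\infty(S^1)$, is regarded as an element of the affine hyperplane $\mathfrak{vir}^*_1$ at level $1$ of the smooth dual of the Virasoro algebra $\mathfrak{vir}=\mathrm{Vect}(S^1)\oplus\mathbb{R}$, with bracket $[(f\partial_x,a),(g\partial_x,b)]=\big((fg'-f'g)\partial_x,\,-\tfrac12\int_{S^1}f'''g\big)$; the pairing of $L$ with $f\partial_x$ is $\int_{S^1}Tf$, and $-L$ lies at level $-1$. In the coadjoint action, $F^{-1}\cdot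 L$ has potential $(F')^2\,(T\circ F)+\tfrac12 S(F)$, where $S(F)=\frac{F'''}{F'}-\frac32\big(\frac{F''}{F'}\big)^2$. For $\ell>0$ let $L(\ell)=\frac{d^2}{dx^2}-\frac{\ell^2}{4}$. Generating vector fields are $\xi_M(m)=\frac{d}{dt}\big|_{0}\exp(-t\xi)\cdot m$, where $\exp(tf\partial_x)$ is the one-parameter group $x\mapsto x-tf(x)+O(t^2)$. Thus $f\partial_x$ generates $(0,-F'f)$ on $N$, and $1\in\mathbb{R}=\mathrm{Lie}(S^1)$ generates $(0,-1)$. A moment map is a smooth equivariant map $\Phi$ with $\omega(\xi_M,\cdot)=-\langle d\Phi,\xi\rangle$. The Kirillov–Kostant–Souriau form of a coadjoint orbit $\mathcal O$ is $\omega_{\mathrm{KKS}}(\xi_{\mathcal O},\eta_{\mathcal O})|_\mu=\langle\mu,[\xi,\eta]\rangle$. The orbit carries the smooth structure of a homogeneous space of $\mathrm{Diff}_o(S^1)$. **Theorem 8.1.** 1. There is a unique $\mathrm{Diff}_o(S^1)$-invariant symplectic form $\omega_N$ on $N$ for which the $\mathrm{Diff}_o(S^1)$-action is Hamiltonian with moment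 map $(\ell,F)\mapsto -F^{-1}\cdot L(\ell)\in\mathfrak{vir}^*_{-1}$. It is given by $$\omega_N=-\frac14\, d\int_{S^1}\Big(\ell^2F'\,dF+(F')^{-1}\,dF''\Big).$$ 2. The form $\omega_N$ is $S^1$-invariant, and the $S^1$-action on $(N,\omega_N)$ is Hamiltonian with moment map $(\ell,F)\mapsto\frac14\ell^2$. 3. For every $\ell>0$, the symplectic quotient $N_{\mathrm{red}}$ of $(N,\omega_N)$ by $S^1$ at level $\frac14\ell^2$ carries a nondegenerate reduced form $\omega_{\mathrm{red}}$, and is the coadjoint Virasoro orbit $\mathcal O$ through $L(\ell)$ with the opposite symplectic structure. More precisely, $[(\ell,F)]\mapsto F^{-1}\cdot L(\ell)$ is a well-defined $\mathrm{Diff}_o(S^1)$-equivariant diffeomorphism $\Psi\colon N_{\mathrm{red}}\to\mathcal O$, its tangent maps are linear isomorphisms onto the tangent spaces of $\mathcal O$, and $\omega_{\mathrm{red}}=-\Psi^*\omega_{\mathrm{KKS}}$. -/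

import Mathlib

open scoped ContDiff

noncomputable section

/-! ## Smooth functions on the circle `S¹ = ℝ / ℤ` -/

/-- The algebra `C^∞(S¹)` of smooth functions on the circle, as a subalgebra of the functions on `ℝ`. -/
def smoothPerAlg : Subalgebra ℝ (ℝ → ℝ) where
  carrier := {f | ContDiff ℝ ∞ f ∧ Function.Periodic f 1}
  mul_mem' := fun ha hb => ⟨ha.1.mul hb.1, ha.2.mul hb.2⟩
  add_mem' := fun ha hb => ⟨ha.1.add hb.1, ha.2.add hb.2⟩
  algebraMap_mem' := fun _ => ⟨contDiff_const, fun _ => rfl⟩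

/-- `C^∞(S¹)`: the smooth `1`-periodic functions on `ℝ`. With the coordinate `x` on `S¹ = ℝ/ℤ`, an
`r`-density `f(x) |dx|^r` is identified with the coefficient function `f`; in particular this is
also the space of vector fields `f ∂ₓ` and of quadratic differentials `f |dx|²`. -/
abbrev SmoothPer : Type := smoothPerAlg

namespace SmoothPer

instance : CoeFun SmoothPer (fun _ => ℝ → ℝ) := ⟨fun f => f.1⟩

/-- The derivative `f'` in the circle direction. -/
def D (f : SmoothPer) : SmoothPer :=
  ⟨deriv f.1, (contDiff_infty_iff_deriv.1 f.2.1).2, fun x => by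
    have h : (fun y => f.1 (y + 1)) = f.1 := funext f.2.2
    rw [← deriv_comp_add_const, h]⟩

/-- `∫_{S¹} f`. -/
def integral (f : SmoothPer) : ℝ := ∫ x in (0 : ℝ)..1, f x

/-- A family of elements of `C^∞(S¹)` with parameters in `ℝⁿ` is smooth if it is jointly smooth in
the parameters and in `x`. -/
def SmoothFamily {n : ℕ} (h : (Fin n → ℝ) → SmoothPer) : Prop :=
  ContDiff ℝ ∞ (fun z : (Fin n → ℝ) × ℝ => h z.1 z.2)

end SmoothPer

/-! ## The group `Diff_o(S¹)` -/

/-- Lifts to `ℝ` of orientation preserving diffeomorphisms of `S¹`. -/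
structure IsCircleLift (G : ℝ → ℝ) : Prop where
  smooth : ContDiff ℝ ∞ G
  deriv_pos : ∀ x, 0 < deriv G x
  map_add_one : ∀ x, G (x + 1) = G x + 1

namespace IsCircleLift

theorem id : IsCircleLift (fun x => x) := ⟨contDiff_id, fun x => by simp, fun _ => rfl⟩

theorem add_const {G : ℝ → ℝ} (hG : IsCircleLift G) (c : ℝ) : IsCircleLift (fun x => G x + c) :=
  ⟨hG.smooth.add contDiff_const, fun x => by simpa using hG.deriv_pos x,
    fun x => by rw [hG.map_add_one]; ring⟩

theorem comp {G H : ℝ → ℝ} (hG : IsCircleLift G) (hH : IsCircleLift H) :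
    IsCircleLift (fun x => G (H x)) where
  smooth := hG.smooth.comp hH.smooth
  deriv_pos := fun x => by
    have h1 := (hG.smooth.differentiable (by simp) (H x)).hasDerivAt
    have h2 := (hH.smooth.differentiable (by simp) x).hasDerivAt
    have h3 : HasDerivAt (fun x => G (H x)) (deriv G (H x) * deriv H x) x := h1.comp x h2
    rw [h3.deriv]
    exact mul_pos (hG.deriv_pos _) (hH.deriv_pos _)
  map_add_one := fun x => by rw [hH.map_add_one, hG.map_add_one]

theorem strictMono {G : ℝ → ℝ} (hG : IsCircleLift G) : StrictMono G :=
  strictMono_of_deriv_pos hG.deriv_pos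

theorem map_add_int {G : ℝ → ℝ} (hG : IsCircleLift G) (x : ℝ) (n : ℤ) : G (x + n) = G x + n := by
  have hper : Function.Periodic (fun y => G y - y) 1 := fun y => by
    simp only [hG.map_add_one]; ring
  have h := hper.int_mul n x
  simp only [mul_one] at h
  linarith

theorem surjective {G : ℝ → ℝ} (hG : IsCircleLift G) : Function.Surjective G := by
  intro y
  obtain ⟨n, hn⟩ := exists_int_gt (y - G 0)
  obtain ⟨m, hm⟩ := exists_int_lt (y - G 0)
  have h1 := hG.map_add_int 0 n
  have h2 := hG.map_add_int 0 m
  rw [zero_add] at h1 h2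
  exact mem_range_of_exists_le_of_exists_ge hG.smooth.continuous
    ⟨m, by rw [h2]; linarith⟩ ⟨n, by rw [h1]; linarith⟩

/-- A lift as a homeomorphism of `ℝ`. -/
def homeo {G : ℝ → ℝ} (hG : IsCircleLift G) : ℝ ≃ₜ ℝ :=
  (hG.strictMono.orderIsoOfSurjective G hG.surjective).toHomeomorph

theorem homeo_apply {G : ℝ → ℝ} (hG : IsCircleLift G) (x : ℝ) : hG.homeo x = G x := rfl

theorem symm {G : ℝ → ℝ} (hG : IsCircleLift G) : IsCircleLift hG.homeo.symm where
  smooth := hG.homeo.contDiff_symm_deriv (fun x => (hG.deriv_pos x).ne')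
    (fun x => (hG.smooth.differentiable (by simp) x).hasDerivAt) hG.smooth
  deriv_pos := fun x => by
    have h := hG.homeo.toOpenPartialHomeomorph.hasDerivAt_symm (a := x) (by simp)
      (hG.deriv_pos (hG.homeo.symm x)).ne'
      (hG.smooth.differentiable (by simp) (hG.homeo.symm x)).hasDerivAt
    have h' : HasDerivAt hG.homeo.symm (deriv G (hG.homeo.symm x))⁻¹ x := h
    rw [h'.deriv]
    exact inv_pos.2 (hG.deriv_pos _)
  map_add_one := fun x => by
    apply hG.homeo.injective
    rw [hG.homeo.apply_symm_apply, homeo_apply, hG.map_add_one, ← homeo_apply hG,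
      hG.homeo.apply_symm_apply]

/-- The self-map of `S¹` induced by a lift. -/
def circleMap {G : ℝ → ℝ} (hG : IsCircleLift G) : UnitAddCircle → UnitAddCircle :=
  Function.Periodic.lift (f := fun x => (G x : UnitAddCircle)) (c := 1) (fun x => by
    simp only [hG.map_add_one]
    exact AddCircle.coe_add_period 1 (G x))

theorem circleMap_coe {G : ℝ → ℝ} (hG : IsCircleLift G) (x : ℝ) :
    hG.circleMap (x : UnitAddCircle) = (G x : UnitAddCircle) := rfl

/-- The bijection of `S¹` induced by a lift. -/
def perm {G : ℝ → ℝ} (hG : IsCircleLift G) : Equiv.Perm UnitAddCircle where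
  toFun := hG.circleMap
  invFun := hG.symm.circleMap
  left_inv := fun y => by
    induction y using QuotientAddGroup.induction_on with
    | H x =>
      rw [circleMap_coe, circleMap_coe, ← homeo_apply hG, hG.homeo.symm_apply_apply]
  right_inv := fun y => by
    induction y using QuotientAddGroup.induction_on with
    | H x =>
      rw [circleMap_coe, circleMap_coe, ← homeo_apply hG, hG.homeo.apply_symm_apply]

theorem perm_coe {G : ℝ → ℝ} (hG : IsCircleLift G) (x : ℝ) :
    hG.perm (x : UnitAddCircle) = (G x : UnitAddCircle) := rfl

end IsCircleLift

/-- The orientation preserving diffeomorphisms of `S¹ = ℝ/ℤ`, as a subgroup of the bijections. -/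
def diffCircleSubgroup : Subgroup (Equiv.Perm UnitAddCircle) where
  carrier := {F | ∃ G, IsCircleLift G ∧ ∀ x : ℝ, F (x : UnitAddCircle) = (G x : UnitAddCircle)}
  mul_mem' := by
    rintro F₁ F₂ ⟨G₁, h₁, e₁⟩ ⟨G₂, h₂, e₂⟩
    exact ⟨fun x => G₁ (G₂ x), h₁.comp h₂, fun x => by rw [Equiv.Perm.mul_apply, e₂, e₁]⟩
  one_mem' := ⟨fun x => x, IsCircleLift.id, fun _ => rfl⟩
  inv_mem' := by
    rintro F ⟨G, h, e⟩
    refine ⟨h.homeo.symm, h.symm, fun x => ?_⟩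
    rw [Equiv.Perm.inv_eq_iff_eq, e, ← h.homeo_apply, h.homeo.apply_symm_apply]

/-- `Diff_o(S¹)`: the group, under composition, of orientation preserving diffeomorphisms of
`S¹ = ℝ/ℤ`. -/
abbrev DiffCircle : Type := diffCircleSubgroup

namespace DiffCircle

/-- `G : ℝ → ℝ` is a lift of the diffeomorphism `F` of `S¹`. -/
def IsLiftOf (G : ℝ → ℝ) (F : DiffCircle) : Prop :=
  IsCircleLift G ∧ ∀ x : ℝ, F.1 (x : UnitAddCircle) = (G x : UnitAddCircle)

/-- The diffeomorphism of `S¹` with a given lift. -/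
def ofLift {G : ℝ → ℝ} (hG : IsCircleLift G) : DiffCircle :=
  ⟨hG.perm, G, hG, hG.perm_coe⟩

/-- A lift of `F` to `ℝ`; it is determined up to an integer constant, and nothing below depends
on the choice. -/
def lift (F : DiffCircle) : ℝ → ℝ := Classical.choose F.2

theorem isLiftOf_lift (F : DiffCircle) : IsLiftOf F.lift F := Classical.choose_spec F.2

/-- `F'` -/
def der (F : DiffCircle) : SmoothPer :=
  ⟨deriv F.lift, (contDiff_infty_iff_deriv.1 F.isLiftOf_lift.1.smooth).2, fun x => by
    have h : (fun y => F.lift (y + 1)) = fun y => F.lift y + 1 :=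
      funext F.isLiftOf_lift.1.map_add_one
    rw [← deriv_comp_add_const, h, deriv_add_const]⟩

/-- `(F')⁻¹` -/
def derInv (F : DiffCircle) : SmoothPer :=
  ⟨fun x => (F.der x)⁻¹, F.der.2.1.inv fun x => (F.isLiftOf_lift.1.deriv_pos x).ne', fun x => by
    simp only [F.der.2.2 x]⟩

/-- The Schwarzian derivative `S(F) = F'''/F' - (3/2) (F''/F')²`. -/
def schwarzian (F : DiffCircle) : SmoothPer :=
  F.der.D.D * F.derInv - (3 / 2 : ℝ) • (F.der.D * F.derInv) ^ 2

/-- `f ∘ F` -/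
def pull (F : DiffCircle) (f : SmoothPer) : SmoothPer :=
  ⟨fun x => f (F.lift x), f.2.1.comp F.isLiftOf_lift.1.smooth, fun x => by
    simp only [F.isLiftOf_lift.1.map_add_one, f.2.2 (F.lift x)]⟩

/-- The rotation `x ↦ x + t` of `S¹`. -/
def rotation (t : UnitAddCircle) : DiffCircle :=
  ⟨Equiv.addRight t, by
    induction t using QuotientAddGroup.induction_on with
    | H s => exact ⟨fun x => x + s, IsCircleLift.id.add_const s, fun x => rfl⟩⟩

theorem rotation_zero : rotation 0 = 1 := by
  apply Subtype.ext; ext x; simp [rotation]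

theorem rotation_add (s t : UnitAddCircle) : rotation (s + t) = rotation s * rotation t := by
  apply Subtype.ext; ext x
  simp [rotation, Equiv.Perm.mul_apply, add_comm, add_left_comm]

/-- A family of diffeomorphisms with parameters in `ℝⁿ` is smooth if it is jointly smooth in the
parameters and in `x`, that is, if it has a jointly smooth family of lifts. -/
def SmoothFamily {n : ℕ} (p : (Fin n → ℝ) → DiffCircle) : Prop :=
  ∃ G : (Fin n → ℝ) → ℝ → ℝ,
    ContDiff ℝ ∞ (fun z : (Fin n → ℝ) × ℝ => G z.1 z.2) ∧ ∀ u, IsLiftOf (G u) (p u)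

end DiffCircle

/-! ## The Virasoro algebra, Hill operators, coadjoint orbits

With the identification of vector fields with elements of the Lie algebra of `Diff_o(S¹)` used
here, `exp(t f ∂ₓ)` is the one-parameter group `x ↦ x - t f(x) + O(t²)`, so that
`(f ∂ₓ) g = d/dt|₀ g ∘ exp(-t f ∂ₓ)` is the usual action on functions. Generating vector fields of
an action on `M` are `ξ_M(m) = d/dt|₀ exp(-tξ) · m`. -/

/-- The Virasoro algebra `𝔳𝔦𝔯(S¹)`, as a vector space: pairs `(f ∂ₓ, a)`. -/
abbrev Vir : Type := SmoothPer × ℝ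

/-- The Virasoro bracket `[(f,a),(g,b)] = (f g' - f' g, -½ ∫ f''' g)`. -/
def virBracket (ξ η : Vir) : Vir :=
  (ξ.1 * η.1.D - ξ.1.D * η.1, -(1 / 2) * (ξ.1.D.D.D * η.1).integral)

/-- The smooth dual of the Virasoro algebra: pairs `(T |dx|², c)`, where `c` is the level. The Hill
operator `L = d²/dx² + T` is the pair `(T, 1)`; the Hill operators form `𝔳𝔦𝔯(S¹)*₁`. -/
abbrev VirDual : Type := SmoothPer × ℝ

/-- The pairing `⟨(T,c),(f,a)⟩ = ∫ T f + c a`. -/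
def virPairing (μ : VirDual) (ξ : Vir) : ℝ := (μ.1 * ξ.1).integral + μ.2 * ξ.2

/-- The Hill operator `d²/dx² + T` as an element of `𝔳𝔦𝔯(S¹)*₁`. -/
def hill (T : SmoothPer) : VirDual := (T, 1)

/-- The coadjoint Virasoro action in the form `(F, μ) ↦ F⁻¹ · μ`. On Hill operators, it takes
`d²/dx² + T` to the Hill operator with potential `(F')² (T ∘ F) + ½ S(F)`. -/
def coadInv (F : DiffCircle) (μ : VirDual) : VirDual :=
  (F.der ^ 2 * F.pull μ.1 + (μ.2 / 2) • F.schwarzian, μ.2)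

/-- The coadjoint Virasoro action `F · μ`. -/
def coad (F : DiffCircle) (μ : VirDual) : VirDual := coadInv F⁻¹ μ

/-- The coadjoint orbit through `μ`. -/
def coadOrbit (μ : VirDual) : Set VirDual := Set.range fun F => coad F μ

/-- The value at `μ` of the generating vector field of `f ∂ₓ` for the coadjoint action, as an
element of `|Ω|²` (the level is constant along the action). For `f ∂ₓ` and `μ = (T, c)` this is
`-(f T' + 2 f' T + (c/2) f''')`. -/
def coadGenerator (f : SmoothPer) (μ : VirDual) : SmoothPer :=
  -(f * μ.1.D + (2 : ℝ) • (f.D * μ.1) + (μ.2 / 2) • f.D.D.D)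

/-- The tangent space at `μ` to the coadjoint orbit through `μ`. -/
def orbitTangent (μ : VirDual) : Set SmoothPer := Set.range fun f => coadGenerator f μ

/-- The Kirillov-Kostant-Souriau form at `μ`, evaluated on the generating vectors of `f ∂ₓ` and
`g ∂ₓ`: it is `⟨μ, [f ∂ₓ, g ∂ₓ]⟩`, with the Virasoro bracket. -/
def kks (μ : VirDual) (f g : SmoothPer) : ℝ := virPairing μ (virBracket (f, 0) (g, 0))

/-- A map from `ℝⁿ` to a coadjoint orbit is smooth, for the structure of a homogeneous space of
`Diff_o(S¹)`, if locally it lifts to a smooth map to the group. -/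
def OrbitSmooth (μ : VirDual) {n : ℕ} (p : (Fin n → ℝ) → coadOrbit μ) : Prop :=
  ∀ u, ∃ F : (Fin n → ℝ) → DiffCircle, DiffCircle.SmoothFamily F ∧
    ∀ᶠ v in nhds u, (p v : VirDual) = coad (F v) μ

/-! ## The trumpet moduli space and its tangent bundle -/

/-- The trumpet moduli space `N = ℝ_{>0} × Diff_o(S¹)`. -/
@[ext]
structure Trumpet where
  len : ℝ
  len_pos : 0 < len
  twist : DiffCircle

/-- The tangent space of `N` at any of its points: pairs `(a, h)` of a variation `a = dℓ` of `ℓ` and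
a variation `h = dF` of `F`, the latter a vector field on `S¹` along `F`. -/
abbrev TrumpetTangent : Type := ℝ × SmoothPer

namespace Trumpet

/-- The straight line `t ↦ (ℓ + t a, F + t h)` in `N` with velocity `(a, h)`; the condition holds for
small `t` (for other `t` the value is immaterial). For fixed `(ℓ, F)` and small `(a, h)`, the points
`(ℓ + a, F + h)` form an affine chart of the Fréchet manifold `N`, and changes of charts are
translations. -/
def translate (m : Trumpet) (w : TrumpetTangent) (t : ℝ) : Trumpet :=
  open Classical in
  if h : 0 < m.len + t * w.1 ∧ IsCircleLift (fun x => m.twist.lift x + t * w.2 x) then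
    ⟨m.len + t * w.1, h.1, DiffCircle.ofLift h.2⟩
  else m

/-- The directional derivative at `m` of a function on `N`. -/
def dirDeriv (g : Trumpet → ℝ) (m : Trumpet) (w : TrumpetTangent) : ℝ :=
  deriv (fun t => g (m.translate w t)) 0

/-- Smooth maps from `ℝⁿ` to `N`. -/
def SmoothFamily {n : ℕ} (p : (Fin n → ℝ) → Trumpet) : Prop :=
  ContDiff ℝ ∞ (fun u => (p u).len) ∧ DiffCircle.SmoothFamily fun u => (p u).twist

/-- Smooth maps from `ℝⁿ` to the fibre of the tangent bundle of `N`. -/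
def SmoothTangentFamily {n : ℕ} (w : (Fin n → ℝ) → TrumpetTangent) : Prop :=
  ContDiff ℝ ∞ (fun u => (w u).1) ∧ SmoothPer.SmoothFamily fun u => (w u).2

/-- A function on `N` is smooth if it is smooth along all smooth finite-dimensional families. -/
def SmoothFun (g : Trumpet → ℝ) : Prop :=
  ∀ (n : ℕ) (p : (Fin n → ℝ) → Trumpet), SmoothFamily p → ContDiff ℝ ∞ fun u => g (p u)

/-- Smooth `1`-forms on `N`. -/
structure IsOneForm (α : Trumpet → TrumpetTangent → ℝ) : Prop where
  linear : ∀ m, IsLinearMap ℝ (α m)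
  smooth : ∀ (n : ℕ) (p : (Fin n → ℝ) → Trumpet) (v : (Fin n → ℝ) → TrumpetTangent),
    SmoothFamily p → SmoothTangentFamily v → ContDiff ℝ ∞ fun u => α (p u) (v u)

/-- Smooth `2`-forms on `N`. -/
structure IsTwoForm (Ω : Trumpet → TrumpetTangent → TrumpetTangent → ℝ) : Prop where
  linear_left : ∀ m w, IsLinearMap ℝ fun v => Ω m v w
  linear_right : ∀ m v, IsLinearMap ℝ (Ω m v)
  alternating : ∀ m v, Ω m v v = 0
  smooth : ∀ (n : ℕ) (p : (Fin n → ℝ) → Trumpet) (v w : (Fin n → ℝ) → TrumpetTangent),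
    SmoothFamily p → SmoothTangentFamily v → SmoothTangentFamily w →
      ContDiff ℝ ∞ fun u => Ω (p u) (v u) (w u)

/-- The exterior derivative of a `1`-form, in the affine charts:
`dα(v,w) = D_v(α(w)) - D_w(α(v))` for constant vector fields `v, w`. -/
def extDerivOne (α : Trumpet → TrumpetTangent → ℝ) (m : Trumpet) (v w : TrumpetTangent) : ℝ :=
  dirDeriv (fun m' => α m' w) m v - dirDeriv (fun m' => α m' v) m w

/-- The exterior derivative of a `2`-form, in the affine charts:
`dΩ(u,v,w) = D_u(Ω(v,w)) + D_v(Ω(w,u)) + D_w(Ω(u,v))` for constant vector fields `u, v, w`. -/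
def extDerivTwo (Ω : Trumpet → TrumpetTangent → TrumpetTangent → ℝ) (m : Trumpet)
    (u v w : TrumpetTangent) : ℝ :=
  dirDeriv (fun m' => Ω m' v w) m u + dirDeriv (fun m' => Ω m' w u) m v +
    dirDeriv (fun m' => Ω m' u v) m w

/-- Symplectic forms on `N`: smooth closed `2`-forms that are (weakly) nondegenerate. -/
structure IsSymplectic (Ω : Trumpet → TrumpetTangent → TrumpetTangent → ℝ) : Prop where
  isTwoForm : IsTwoForm Ω
  closed : ∀ m u v w, extDerivTwo Ω m u v w = 0
  nondegenerate : ∀ m v, (∀ w, Ω m v w = 0) → v = 0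

/-! ## The two actions -/

/-- The action `F₁ · (ℓ, F) = (ℓ, F ∘ F₁⁻¹)` of `Diff_o(S¹)`. -/
instance : MulAction DiffCircle Trumpet where
  smul F₁ m := ⟨m.len, m.len_pos, m.twist * F₁⁻¹⟩
  one_smul m := Trumpet.ext rfl (by change m.twist * 1⁻¹ = m.twist; simp)
  mul_smul F₁ F₂ m := Trumpet.ext rfl (by
    change m.twist * (F₁ * F₂)⁻¹ = m.twist * F₂⁻¹ * F₁⁻¹
    rw [mul_inv_rev, mul_assoc])

/-- The tangent map of the action of `F₁`: it takes `(a, h)` to `(a, h ∘ F₁⁻¹)`. -/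
def diffTangent (F₁ : DiffCircle) (w : TrumpetTangent) : TrumpetTangent := (w.1, F₁⁻¹.pull w.2)

/-- The generating vector field of `f ∂ₓ`: the derivative at `t = 0` of
`exp(-t f ∂ₓ) · (ℓ, F) = (ℓ, F ∘ exp(t f ∂ₓ))`, which is `(0, -F' f)`. -/
def diffGenerator (f : SmoothPer) (m : Trumpet) : TrumpetTangent := (0, -(m.twist.der * f))

/-- The action `t · (ℓ, F) = (ℓ, F + t)` of `S¹ = ℝ/ℤ`. Its tangent maps are the identity of
`TrumpetTangent`. -/
instance : AddAction UnitAddCircle Trumpet where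
  vadd t m := ⟨m.len, m.len_pos, DiffCircle.rotation t * m.twist⟩
  zero_vadd m := Trumpet.ext rfl (by
    change DiffCircle.rotation 0 * m.twist = m.twist
    rw [DiffCircle.rotation_zero, one_mul])
  add_vadd s t m := Trumpet.ext rfl (by
    change DiffCircle.rotation (s + t) * m.twist =
      DiffCircle.rotation s * (DiffCircle.rotation t * m.twist)
    rw [DiffCircle.rotation_add, mul_assoc])

/-- The generating vector field of `1 ∈ ℝ = Lie(S¹)`: the derivative at `t = 0` of
`(-t) · (ℓ, F) = (ℓ, F - t)`. -/
def circleGenerator : TrumpetTangent := (0, -1)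

/-- The moment map condition, for an equivariant smooth map `Φ : N → 𝔳𝔦𝔯(S¹)*_c` to the affine
subspace at some level `c`: `Ω(ξ_N, ·) = -⟨dΦ, ξ⟩` for all vector fields `ξ = f ∂ₓ`. -/
structure IsDiffMomentMap (Ω : Trumpet → TrumpetTangent → TrumpetTangent → ℝ)
    (Φ : Trumpet → VirDual) (c : ℝ) : Prop where
  level : ∀ m, (Φ m).2 = c
  smooth : ∀ (n : ℕ) (p : (Fin n → ℝ) → Trumpet), SmoothFamily p →
    SmoothPer.SmoothFamily fun u => (Φ (p u)).1
  equivariant : ∀ (F : DiffCircle) (m : Trumpet), Φ (F • m) = coad F (Φ m)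
  moment : ∀ (f : SmoothPer) (m : Trumpet) (w : TrumpetTangent),
    HasDerivAt (fun t => virPairing (Φ (m.translate w t)) (f, 0))
      (-Ω m (diffGenerator f m) w) 0

/-- `Ω` is a `Diff_o(S¹)`-invariant symplectic form for which the action of `Diff_o(S¹)` on `N` is
Hamiltonian, with moment map `Φ` (at level `c`). -/
structure IsDiffHamiltonian (Ω : Trumpet → TrumpetTangent → TrumpetTangent → ℝ)
    (Φ : Trumpet → VirDual) (c : ℝ) : Prop where
  symplectic : IsSymplectic Ω
  invariant : ∀ (F : DiffCircle) (m : Trumpet) (v w : TrumpetTangent),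
    Ω (F • m) (diffTangent F v) (diffTangent F w) = Ω m v w
  momentMap : IsDiffMomentMap Ω Φ c

/-- `Ω` is an `S¹`-invariant symplectic form for which the action of `S¹` on `N` is Hamiltonian,
with moment map `J`. -/
structure IsCircleHamiltonian (Ω : Trumpet → TrumpetTangent → TrumpetTangent → ℝ)
    (J : Trumpet → ℝ) : Prop where
  symplectic : IsSymplectic Ω
  invariant : ∀ (t : UnitAddCircle) (m : Trumpet) (v w : TrumpetTangent),
    Ω (t +ᵥ m) v w = Ω m v w
  smooth : SmoothFun J
  moment_invariant : ∀ (t : UnitAddCircle) (m : Trumpet), J (t +ᵥ m) = J m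
  moment : ∀ (m : Trumpet) (w : TrumpetTangent),
    HasDerivAt (fun t => J (m.translate w t)) (-Ω m circleGenerator w) 0

/-! ## The objects of the theorem -/

/-- The constant Hill potential `T(ℓ) = -ℓ²/4`. -/
def hillPotential (ℓ : ℝ) : SmoothPer := algebraMap ℝ SmoothPer (-(ℓ ^ 2) / 4)

/-- The `1`-form `∫ (ℓ² F' dF + (F')⁻¹ dF'')` on `N`. -/
def potentialForm (m : Trumpet) (w : TrumpetTangent) : ℝ :=
  (m.len ^ 2 • (m.twist.der * w.2) + m.twist.derInv * w.2.D.D).integral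

/-- The `2`-form `ω_N = -¼ d ∫ (ℓ² F' dF + (F')⁻¹ dF'')`. -/
def omega (m : Trumpet) (v w : TrumpetTangent) : ℝ := -(1 / 4) * extDerivOne potentialForm m v w

/-- The map `(ℓ, F) ↦ -F⁻¹ · L(ℓ)`. -/
def diffMoment (m : Trumpet) : VirDual := -coadInv m.twist (hill (hillPotential m.len))

/-- The map `(ℓ, F) ↦ ℓ²/4`. -/
def circleMoment (m : Trumpet) : ℝ := m.len ^ 2 / 4

/-! ## Reduction by the circle action -/

/-- The level set of the `S¹`-moment map at level `c`. -/
def LevelSet (c : ℝ) : Type := {m : Trumpet // circleMoment m = c}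

instance (c : ℝ) : AddAction UnitAddCircle (LevelSet c) where
  vadd t m := ⟨t +ᵥ m.1, m.2⟩
  zero_vadd m := Subtype.ext (zero_vadd UnitAddCircle m.1)
  add_vadd s t m := Subtype.ext (add_vadd s t m.1)

instance (c : ℝ) : MulAction DiffCircle (LevelSet c) where
  smul F m := ⟨F • m.1, m.2⟩
  one_smul m := Subtype.ext (one_smul DiffCircle m.1)
  mul_smul F₁ F₂ m := Subtype.ext (mul_smul F₁ F₂ m.1)

/-- The reduced space: the quotient of the level set by `S¹`. -/
abbrev Reduced (c : ℝ) : Type := AddAction.orbitRel.Quotient UnitAddCircle (LevelSet c)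

/-- The quotient map from the level set to the reduced space. -/
def toReduced {c : ℝ} (m : LevelSet c) : Reduced c := Quotient.mk _ m

/-- The tangent space of the reduced space at any of its points: variations `h` of `F` modulo the
constant ones, which are tangent to the `S¹`-orbits. (`S¹` acts trivially on the variations.) -/
abbrev ReducedTangent : Type := SmoothPer ⧸ Submodule.span ℝ {(1 : SmoothPer)}

/-- The tangent map of the quotient map, applied to a vector tangent to the level set. -/
def toReducedTangent (w : TrumpetTangent) : ReducedTangent := Submodule.Quotient.mk w.2

/-- Smooth maps from `ℝⁿ` to the reduced space: those which locally lift to smooth maps to the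
level set. -/
def ReducedSmooth {c : ℝ} {n : ℕ} (p : (Fin n → ℝ) → Reduced c) : Prop :=
  ∀ u, ∃ q : (Fin n → ℝ) → LevelSet c, SmoothFamily (fun v => (q v).1) ∧
    ∀ᶠ v in nhds u, p v = toReduced (q v)

/-- `Ωred` is the reduction of `Ω` at level `c`: its pullback to the level set is the restriction of
`Ω` to the level set, whose tangent spaces are the kernels of the differential of the moment map. -/
def IsReducedForm (Ω : Trumpet → TrumpetTangent → TrumpetTangent → ℝ) (c : ℝ)
    (Ωred : Reduced c → ReducedTangent → ReducedTangent → ℝ) : Prop :=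
  ∀ (m : LevelSet c) (v w : TrumpetTangent),
    dirDeriv circleMoment m.1 v = 0 → dirDeriv circleMoment m.1 w = 0 →
      Ωred (toReduced m) (toReducedTangent v) (toReducedTangent w) = Ω m.1 v w

end Trumpet

end

open scoped ContDiff Topology
open DiffCircle

/-! Every object in the theorem sees `F` only through `P = F'`. For `F⁻¹ · L(ℓ)` this is because the
potential of `L(ℓ)` is constant. This gives the rotation invariance and makes all constructions
descend to the quotient.

Carrying out the exterior derivative turns `ω_N` into the integral of `omegaDensity`, with no
integration by parts. Closedness is then a pointwise cyclic cancellation.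

The central identity is `integral_momentVariation`: the variation of `-F⁻¹ · L(ℓ)`, paired with `f`,
equals `-ω_N(-F'f, ·)` up to a total derivative. It gives the moment map. It also gives uniqueness,
since the generators `-F'f` exhaust the variations of `F`, and the one remaining direction `∂_ℓ`
pairs to zero with itself. At fixed `ℓ` it expresses the reduced form through the variation of the
Hill operator.

Positivity enters twice, each time as a vanishing integral of a sum of squares. In
`D_eq_zero_of_omega_eq_zero`, testing a variation `h` against `h'/F'` shows that the kernel of `ω_N`
on a level set consists of constants; this yields nondegeneracy both on `N` and on the quotient. In
`der_eq_one_of_coadInv_hill_eq`, integrating the stabilizer equation shows that only rotations fix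
`L(ℓ)`, so `Ψ` is injective.

A variation that leaves the Hill operator fixed to first order lies in the kernel of the reduced
form, so the tangent maps of `Ψ` are injective. On generators the reduced form becomes the pairing
of a coadjoint vector with a vector field, which is minus the KKS form (`kks_eq`). Both smooth
structures are defined by local lifts to `Diff_o(S¹)`, and smooth inversion of families matches
them. -/

namespace SmoothPer

/-! ### Differential and integral calculus in `C^∞(S¹)`. -/

theorem ext' {f g : SmoothPer} (h : ∀ x, f x = g x) : f = g := Subtype.ext (funext h)

theorem contDiff (f : SmoothPer) : ContDiff ℝ ∞ f.1 := f.2.1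

@[fun_prop]
theorem continuous (f : SmoothPer) : Continuous f.1 := f.2.1.continuous

theorem periodic (f : SmoothPer) : Function.Periodic f.1 1 := f.2.2

theorem hasDerivAt (f : SmoothPer) (x : ℝ) : HasDerivAt f.1 (f.D x) x :=
  (f.2.1.differentiable (by simp) x).hasDerivAt

theorem D_eq_of_hasDerivAt {f g : SmoothPer} (h : ∀ x, HasDerivAt f.1 (g x) x) : f.D = g :=
  ext' fun x => (h x).deriv

@[simp] theorem add_apply (f g : SmoothPer) (x : ℝ) : (f + g) x = f x + g x := rfl
@[simp] theorem sub_apply (f g : SmoothPer) (x : ℝ) : (f - g) x = f x - g x := rfl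
@[simp] theorem neg_apply (f : SmoothPer) (x : ℝ) : (-f) x = -f x := rfl
@[simp] theorem mul_apply (f g : SmoothPer) (x : ℝ) : (f * g) x = f x * g x := rfl
@[simp] theorem pow_apply (f : SmoothPer) (n : ℕ) (x : ℝ) : (f ^ n) x = f x ^ n := rfl
@[simp] theorem smul_apply (c : ℝ) (f : SmoothPer) (x : ℝ) : (c • f) x = c * f x := rfl
@[simp] theorem one_apply (x : ℝ) : (1 : SmoothPer) x = 1 := rfl
@[simp] theorem algebraMap_apply (c x : ℝ) : (algebraMap ℝ SmoothPer c) x = c := rfl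

@[simp] theorem D_add (f g : SmoothPer) : (f + g).D = f.D + g.D :=
  D_eq_of_hasDerivAt fun x => (f.hasDerivAt x).add (g.hasDerivAt x)

@[simp] theorem D_sub (f g : SmoothPer) : (f - g).D = f.D - g.D :=
  D_eq_of_hasDerivAt fun x => (f.hasDerivAt x).sub (g.hasDerivAt x)

@[simp] theorem D_neg (f : SmoothPer) : (-f).D = -f.D :=
  D_eq_of_hasDerivAt fun x => (f.hasDerivAt x).neg

@[simp] theorem D_smul (c : ℝ) (f : SmoothPer) : (c • f).D = c • f.D :=
  D_eq_of_hasDerivAt fun x => (f.hasDerivAt x).const_mul c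

@[simp] theorem D_mul (f g : SmoothPer) : (f * g).D = f.D * g + f * g.D :=
  D_eq_of_hasDerivAt fun x => (f.hasDerivAt x).mul (g.hasDerivAt x)

@[simp] theorem D_one : (1 : SmoothPer).D = 0 :=
  D_eq_of_hasDerivAt fun x => hasDerivAt_const x (1 : ℝ)

@[simp] theorem D_zero : (0 : SmoothPer).D = 0 :=
  D_eq_of_hasDerivAt fun x => hasDerivAt_const x (0 : ℝ)

theorem intervalIntegrable (f : SmoothPer) (a b : ℝ) :
    IntervalIntegrable f.1 MeasureTheory.volume a b := f.continuous.intervalIntegrable a b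

@[simp] theorem integral_add (f g : SmoothPer) : (f + g).integral = f.integral + g.integral :=
  intervalIntegral.integral_add (f.intervalIntegrable _ _) (g.intervalIntegrable _ _)

@[simp] theorem integral_sub (f g : SmoothPer) : (f - g).integral = f.integral - g.integral :=
  intervalIntegral.integral_sub (f.intervalIntegrable _ _) (g.intervalIntegrable _ _)

@[simp] theorem integral_neg (f : SmoothPer) : (-f).integral = -f.integral :=
  intervalIntegral.integral_neg

@[simp] theorem integral_smul (c : ℝ) (f : SmoothPer) : (c • f).integral = c * f.integral :=
  intervalIntegral.integral_const_mul c f.1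

@[simp] theorem integral_zero : (0 : SmoothPer).integral = 0 := by
  simp [integral]

@[simp] theorem integral_one : (1 : SmoothPer).integral = 1 := by
  simp [integral]

@[simp] theorem integral_D (f : SmoothPer) : f.D.integral = 0 := by
  have h := intervalIntegral.integral_eq_sub_of_hasDerivAt (a := 0) (b := 1)
    (fun x _ => f.hasDerivAt x) (f.D.intervalIntegrable _ _)
  have hp := f.periodic 0
  rw [zero_add] at hp
  rw [integral, h, hp, sub_self]

/-- Functions differing by a derivative have the same integral. -/
theorem integral_eq_of_sub_eq_D {f g h : SmoothPer} (e : f - g = h.D) :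
    f.integral = g.integral := by
  have := congrArg integral e
  rw [integral_sub, integral_D] at this
  linarith

/-- Converts the two energy identities of the proof, integrals of sums of squares equal to zero,
into pointwise statements. -/
theorem eq_zero_of_integral_eq_zero {f : SmoothPer} (h0 : ∀ x, 0 ≤ f x) (h : f.integral = 0) :
    f = 0 := by
  have hI : ∀ x ∈ Set.Icc (0 : ℝ) 1, f x = 0 := by
    by_contra! hc
    obtain ⟨x, hx, hne⟩ := hc
    have hpos : 0 < ∫ y in (0 : ℝ)..1, f y :=
      intervalIntegral.integral_pos (by norm_num) f.continuous.continuousOn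
        (fun y _ => h0 y) ⟨x, hx, lt_of_le_of_ne (h0 x) (Ne.symm hne)⟩
    exact hpos.ne' h
  refine ext' fun x => ?_
  obtain ⟨y, hy, hxy⟩ := f.periodic.exists_mem_Ico₀ (by norm_num) x
  exact hxy.trans (hI y ⟨hy.1, hy.2.le⟩)

theorem eq_const_of_D_eq_zero {f : SmoothPer} (h : f.D = 0) : f = f 0 • (1 : SmoothPer) := by
  refine ext' fun x => ?_
  have := is_const_of_deriv_eq_zero (f.2.1.differentiable (by simp))
    (fun y => congrArg (fun g : SmoothPer => g y) h) x 0
  simpa using this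

/-- The integral over `S¹` as the integral over any interval of length one. -/
theorem integral_eq_shift (f : SmoothPer) (a : ℝ) : ∫ x in a..(a + 1), f x = f.integral := by
  rw [f.periodic.intervalIntegral_add_eq a 0, zero_add, integral]

end SmoothPer

/-! ### Lifts, derivatives and Schwarzians of circle diffeomorphisms. -/

namespace DiffCircle

/-- The difference of two lifts is continuous and integer valued, hence constant on the connected
line. Thus `der` and `pull` may be computed with any lift, not only the chosen one. -/
theorem IsLiftOf.exists_add_const {G H : ℝ → ℝ} {F : DiffCircle} (hG : IsLiftOf G F)
    (hH : IsLiftOf H F) : ∃ n : ℤ, ∀ x, G x = H x + n := by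
  have h : ∀ x, ∃ n : ℤ, (n : ℝ) = G x - H x := fun x => by
    have e : (G x : UnitAddCircle) = (H x : UnitAddCircle) := (hG.2 x).symm.trans (hH.2 x)
    rw [← sub_eq_zero, ← AddCircle.coe_sub, AddCircle.coe_eq_zero_iff] at e
    obtain ⟨n, hn⟩ := e
    exact ⟨n, by simpa using hn⟩
  choose n hn using h
  have hc : Continuous n := by
    rw [Int.isClosedEmbedding_coe_real.isEmbedding.continuous_iff]
    have : (Int.cast ∘ n : ℝ → ℝ) = fun x => G x - H x := funext hn
    rw [this]
    exact hG.1.smooth.continuous.sub hH.1.smooth.continuous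
  refine ⟨n 0, fun x => ?_⟩
  rw [← PreconnectedSpace.constant inferInstance hc (x := x) (y := 0), hn x]
  ring

theorem IsLiftOf.der_apply {G : ℝ → ℝ} {F : DiffCircle} (hG : IsLiftOf G F) (x : ℝ) :
    F.der x = deriv G x := by
  obtain ⟨n, hn⟩ := F.isLiftOf_lift.exists_add_const hG
  change deriv F.lift x = _
  rw [funext hn, deriv_add_const]

theorem IsLiftOf.pull_apply {G : ℝ → ℝ} {F : DiffCircle} (hG : IsLiftOf G F) (f : SmoothPer)
    (x : ℝ) : F.pull f x = f (G x) := by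
  obtain ⟨n, hn⟩ := F.isLiftOf_lift.exists_add_const hG
  change f (F.lift x) = _
  rw [hn]
  simpa using f.periodic.int_mul n (G x)

theorem isLiftOf_ofLift {G : ℝ → ℝ} (hG : IsCircleLift G) : IsLiftOf G (ofLift hG) :=
  ⟨hG, hG.perm_coe⟩

theorem IsLiftOf.mul {G H : ℝ → ℝ} {F K : DiffCircle} (hG : IsLiftOf G F) (hH : IsLiftOf H K) :
    IsLiftOf (fun x => G (H x)) (F * K) :=
  ⟨hG.1.comp hH.1, fun x => by
    change F.1 (K.1 x) = _
    rw [hH.2, hG.2]⟩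

theorem IsLiftOf.hasDerivAt {G : ℝ → ℝ} {F : DiffCircle} (hG : IsLiftOf G F) (x : ℝ) :
    HasDerivAt G (F.der x) x := by
  rw [hG.der_apply]
  exact (hG.1.smooth.differentiable (by simp) x).hasDerivAt

theorem hasDerivAt_lift (F : DiffCircle) (x : ℝ) : HasDerivAt F.lift (F.der x) x :=
  F.isLiftOf_lift.hasDerivAt x

theorem der_pos (F : DiffCircle) (x : ℝ) : 0 < F.der x := F.isLiftOf_lift.1.deriv_pos x

theorem der_mul_derInv (F : DiffCircle) : F.der * F.derInv = 1 :=
  SmoothPer.ext' fun x => mul_inv_cancel₀ (F.der_pos x).ne'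

theorem derInv_apply (F : DiffCircle) (x : ℝ) : F.derInv x = (F.der x)⁻¹ := rfl

@[simp] theorem D_derInv (F : DiffCircle) : F.derInv.D = -(F.der.D * F.derInv ^ 2) :=
  SmoothPer.D_eq_of_hasDerivAt fun x => by
    refine ((F.der.hasDerivAt x).fun_inv (F.der_pos x).ne').congr_deriv ?_
    simp only [SmoothPer.neg_apply, SmoothPer.mul_apply, SmoothPer.pow_apply, derInv_apply]
    field_simp

theorem derInv_eq_of_der_eq {F G : DiffCircle} (h : F.der = G.der) : F.derInv = G.derInv :=
  SmoothPer.ext' fun x => by rw [derInv_apply, derInv_apply, h]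

theorem schwarzian_eq_of_der_eq {F G : DiffCircle} (h : F.der = G.der) :
    F.schwarzian = G.schwarzian := by
  rw [schwarzian, schwarzian, derInv_eq_of_der_eq h, h]

theorem der_mul (F G : DiffCircle) : (F * G).der = G.pull F.der * G.der :=
  SmoothPer.ext' fun x => by
    have h := (F.isLiftOf_lift.mul G.isLiftOf_lift)
    rw [h.der_apply]
    exact ((F.hasDerivAt_lift (G.lift x)).comp x (G.hasDerivAt_lift x)).deriv

@[simp] theorem D_pull (F : DiffCircle) (f : SmoothPer) : (F.pull f).D = F.pull f.D * F.der :=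
  SmoothPer.D_eq_of_hasDerivAt fun x => (f.hasDerivAt (F.lift x)).comp x (F.hasDerivAt_lift x)

@[simp] theorem pull_add (F : DiffCircle) (f g : SmoothPer) :
    F.pull (f + g) = F.pull f + F.pull g := rfl
@[simp] theorem pull_sub (F : DiffCircle) (f g : SmoothPer) :
    F.pull (f - g) = F.pull f - F.pull g := rfl
@[simp] theorem pull_neg (F : DiffCircle) (f : SmoothPer) : F.pull (-f) = -F.pull f := rfl
@[simp] theorem pull_mul (F : DiffCircle) (f g : SmoothPer) :
    F.pull (f * g) = F.pull f * F.pull g := rfl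
@[simp] theorem pull_pow (F : DiffCircle) (f : SmoothPer) (n : ℕ) :
    F.pull (f ^ n) = F.pull f ^ n := rfl
@[simp] theorem pull_smul (F : DiffCircle) (c : ℝ) (f : SmoothPer) :
    F.pull (c • f) = c • F.pull f := rfl
@[simp] theorem pull_one (F : DiffCircle) : F.pull 1 = 1 := rfl
@[simp] theorem pull_algebraMap (F : DiffCircle) (c : ℝ) :
    F.pull (algebraMap ℝ SmoothPer c) = algebraMap ℝ SmoothPer c := rfl

theorem pull_mul_left (F G : DiffCircle) (f : SmoothPer) :
    (F * G).pull f = G.pull (F.pull f) :=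
  SmoothPer.ext' fun x => (F.isLiftOf_lift.mul G.isLiftOf_lift).pull_apply f x

theorem isLiftOf_one : IsLiftOf (fun x => x) 1 := ⟨IsCircleLift.id, fun _ => rfl⟩

@[simp] theorem one_pull (f : SmoothPer) : (1 : DiffCircle).pull f = f :=
  SmoothPer.ext' fun x => isLiftOf_one.pull_apply f x

@[simp] theorem der_one : (1 : DiffCircle).der = 1 :=
  SmoothPer.ext' fun x => by rw [isLiftOf_one.der_apply]; simp

theorem derInv_mul (F G : DiffCircle) : (F * G).derInv = G.pull F.derInv * G.derInv :=
  SmoothPer.ext' fun x => by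
    rw [derInv_apply, der_mul]
    simp only [SmoothPer.mul_apply, derInv_apply, mul_inv]
    rfl

/-- The cocycle property of the Schwarzian derivative. -/
theorem schwarzian_mul (F G : DiffCircle) :
    (F * G).schwarzian = G.der ^ 2 * G.pull F.schwarzian + G.schwarzian := by
  apply SmoothPer.ext'
  intro x
  have h1 := (F.der_pos (G.lift x)).ne'
  have h2 := (G.der_pos x).ne'
  simp only [schwarzian, der_mul, derInv_mul, SmoothPer.D_add, SmoothPer.D_mul, D_pull,
    pull_sub, pull_smul, pull_mul, pull_pow,
    SmoothPer.add_apply, SmoothPer.sub_apply, SmoothPer.mul_apply, SmoothPer.smul_apply,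
    SmoothPer.pow_apply]
  have e1 : (G.pull F.derInv) x = (F.der (G.lift x))⁻¹ := rfl
  have e2 : (G.pull F.der) x = F.der (G.lift x) := rfl
  rw [e1, e2, derInv_apply]
  field_simp
  ring

@[simp] theorem integral_der (F : DiffCircle) : F.der.integral = 1 := by
  have h := intervalIntegral.integral_eq_sub_of_hasDerivAt (a := 0) (b := 1)
    (fun x _ => F.hasDerivAt_lift x) (F.der.intervalIntegrable _ _)
  have h2 := F.isLiftOf_lift.1.map_add_one 0
  rw [zero_add] at h2
  rw [SmoothPer.integral, h, h2]
  ring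

/-- Change of variables on the circle. -/
theorem integral_pull_mul_der (F : DiffCircle) (f : SmoothPer) :
    (F.pull f * F.der).integral = f.integral := by
  have h := intervalIntegral.integral_comp_mul_deriv (a := 0) (b := 1)
    (fun x _ => F.hasDerivAt_lift x) F.der.continuous.continuousOn f.continuous
  have h2 := F.isLiftOf_lift.1.map_add_one 0
  rw [zero_add] at h2
  rw [h2, f.integral_eq_shift] at h
  exact h

theorem isLiftOf_rotation (s : ℝ) : IsLiftOf (fun x => x + s) (rotation (s : UnitAddCircle)) :=
  ⟨IsCircleLift.id.add_const s, fun _ => rfl⟩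

@[simp] theorem der_rotation (t : UnitAddCircle) : (rotation t).der = 1 := by
  induction t using QuotientAddGroup.induction_on with
  | H s =>
    refine SmoothPer.ext' fun x => ?_
    rw [(isLiftOf_rotation s).der_apply]
    simp

/-- A diffeomorphism with derivative one is a rotation. -/
theorem eq_rotation_of_der_eq_one {F : DiffCircle} (h : F.der = 1) :
    F = rotation (F.lift 0 : UnitAddCircle) := by
  have hc : ∀ x, F.lift x = x + F.lift 0 := fun x => by
    have hd : ∀ y, HasDerivAt (fun y => F.lift y - y) 0 y := fun y => by
      have := (F.hasDerivAt_lift y).fun_sub (hasDerivAt_id' y)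
      rw [h] at this
      simpa using this
    have := is_const_of_deriv_eq_zero (fun y => (hd y).differentiableAt)
      (fun y => (hd y).deriv) x 0
    linarith
  apply Subtype.ext
  ext y
  induction y using QuotientAddGroup.induction_on with
  | H x =>
    rw [F.isLiftOf_lift.2, hc]
    rfl

end DiffCircle

/-! ### Differentiation under the integral sign and small variations of a diffeomorphism. -/

open MeasureTheory in
/-- Differentiation under the integral sign over a compact interval. -/
theorem hasDerivAt_intervalIntegral_of_continuousOn {g g' : ℝ → ℝ → ℝ} {a b t₀ ε : ℝ} (hε : 0 < ε)
    (hg : ∀ t ∈ Metric.ball t₀ ε, Continuous (g t))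
    (hd : ∀ t ∈ Metric.ball t₀ ε, ∀ x, HasDerivAt (fun s => g s x) (g' t x) t)
    (hg' : ContinuousOn (Function.uncurry g') (Metric.ball t₀ ε ×ˢ Set.univ)) :
    HasDerivAt (fun t => ∫ x in a..b, g t x) (∫ x in a..b, g' t₀ x) t₀ := by
  have hsub : Metric.closedBall t₀ (ε / 2) ⊆ Metric.ball t₀ ε :=
    Metric.closedBall_subset_ball (by linarith)
  obtain ⟨C, hC⟩ := ((isCompact_closedBall t₀ (ε / 2)).prod
    (isCompact_uIcc (a := a) (b := b))).exists_bound_of_continuousOn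
    (hg'.mono (Set.prod_mono hsub (Set.subset_univ _)))
  have h0 : t₀ ∈ Metric.ball t₀ ε := Metric.mem_ball_self hε
  have hc' : Continuous (g' t₀) :=
    continuousOn_univ.1 (hg'.comp (f := fun x => (t₀, x)) (by fun_prop) fun x _ => ⟨h0, trivial⟩)
  have hball : Metric.ball t₀ (ε / 2) ⊆ Metric.ball t₀ ε := Metric.ball_subset_ball (by linarith)
  refine (intervalIntegral.hasDerivAt_integral_of_dominated_loc_of_deriv_le
    (F := g) (F' := g') (bound := fun _ => C)
    (Metric.ball_mem_nhds t₀ (half_pos hε)) ?_ ((hg t₀ h0).intervalIntegrable _ _)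
    hc'.aestronglyMeasurable ?_ intervalIntegrable_const ?_).2
  · filter_upwards [Metric.ball_mem_nhds t₀ hε] with t ht
    exact (hg t ht).aestronglyMeasurable
  · refine Filter.Eventually.of_forall fun x hx t ht => ?_
    exact hC (t, x) ⟨Metric.ball_subset_closedBall ht, Set.uIoc_subset_uIcc hx⟩
  · exact Filter.Eventually.of_forall fun x _ t ht => hd t (hball ht) x

theorem SmoothPer.exists_bound (f : SmoothPer) : ∃ C, 0 < C ∧ ∀ x, |f x| ≤ C := by
  obtain ⟨C, hC⟩ := isCompact_Icc.exists_bound_of_continuousOn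
    (f.continuous.continuousOn (s := Set.Icc (0 : ℝ) 1))
  refine ⟨max C 1, by positivity, fun x => ?_⟩
  obtain ⟨y, hy, hxy⟩ := f.periodic.exists_mem_Ico₀ (by norm_num) x
  rw [hxy]
  exact (hC y ⟨hy.1, hy.2.le⟩).trans (le_max_left _ _)

/-- For small `t`, the variation `F + t h` of a diffeomorphism stays a diffeomorphism. -/
theorem DiffCircle.exists_ball_pos (F : DiffCircle) (h : SmoothPer) :
    ∃ ε > 0, ∀ t ∈ Metric.ball (0 : ℝ) ε, ∀ x, 0 < F.der x + t * h.D x := by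
  -- Since `F' + t h' = F' (1 + t h'/F')`, a bound on `h'/F'` controls the sign for small `t`.
  obtain ⟨C, hC0, hC⟩ := (F.derInv * h.D).exists_bound
  refine ⟨C⁻¹, inv_pos.2 hC0, fun t ht x => ?_⟩
  have hp := F.der_pos x
  have ht' : |t| < C⁻¹ := by simpa using ht
  have h1 : |t * (F.derInv * h.D) x| < 1 := by
    rw [abs_mul]
    calc |t| * |(F.derInv * h.D) x| ≤ |t| * C := by gcongr; exact hC x
      _ < C⁻¹ * C := by gcongr
      _ = 1 := inv_mul_cancel₀ hC0.ne'
  have h2 : F.der x + t * h.D x = F.der x * (1 + t * (F.derInv * h.D) x) := by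
    rw [SmoothPer.mul_apply, F.derInv_apply]
    field_simp
  rw [h2]
  exact mul_pos hp (by linarith [(abs_lt.1 h1).1])

/-! ### Straight lines in `N`, the explicit form of `ω_N`, and closedness. -/

namespace Trumpet

/-- Positivity selects the meaningful branch of `translate`. Only `ℓ` and `F'` are recorded: the
chosen lift of the new diffeomorphism may differ by an integer from the one used to build it, and
nothing later needs more. -/
theorem translate_of_pos {m : Trumpet} {w : TrumpetTangent} {t : ℝ}
    (h1 : 0 < m.len + t * w.1) (h2 : ∀ x, 0 < m.twist.der x + t * w.2.D x) :
    (m.translate w t).len = m.len + t * w.1 ∧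
      (m.translate w t).twist.der = m.twist.der + t • w.2.D := by
  have hd : ∀ x, HasDerivAt (fun x => m.twist.lift x + t * w.2 x)
      (m.twist.der x + t * w.2.D x) x := fun x =>
    (m.twist.hasDerivAt_lift x).fun_add ((w.2.hasDerivAt x).const_mul t)
  have h3 : IsCircleLift (fun x => m.twist.lift x + t * w.2 x) :=
    { smooth := m.twist.isLiftOf_lift.1.smooth.add (contDiff_const.mul w.2.contDiff)
      deriv_pos := fun x => by rw [(hd x).deriv]; exact h2 x
      map_add_one := fun x => by
        rw [m.twist.isLiftOf_lift.1.map_add_one, w.2.periodic x]; ring }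
  rw [translate, dif_pos ⟨h1, h3⟩]
  refine ⟨rfl, SmoothPer.ext' fun x => ?_⟩
  rw [(DiffCircle.isLiftOf_ofLift h3).der_apply]
  exact (hd x).deriv

/-- On a small interval, the straight line `t ↦ (ℓ + t a, F + t h)` is defined. -/
theorem exists_ball_translate (m : Trumpet) (w : TrumpetTangent) :
    ∃ ε > 0, ∀ t ∈ Metric.ball (0 : ℝ) ε, (∀ x, 0 < m.twist.der x + t * w.2.D x) ∧
      (m.translate w t).len = m.len + t * w.1 ∧
      (m.translate w t).twist.der = m.twist.der + t • w.2.D := by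
  obtain ⟨ε, hε, h⟩ := m.twist.exists_ball_pos w.2
  have hev : ∀ᶠ t in 𝓝 (0 : ℝ), 0 < m.len + t * w.1 := by
    have hc : Continuous fun t : ℝ => m.len + t * w.1 := by fun_prop
    exact hc.continuousAt.eventually (lt_mem_nhds (by simpa using m.len_pos))
  obtain ⟨δ, hδ, h'⟩ := Metric.eventually_nhds_iff_ball.1 hev
  refine ⟨min ε δ, lt_min hε hδ, fun t ht => ?_⟩
  have h1 := h t (Metric.ball_subset_ball (min_le_left _ _) ht)
  exact ⟨h1, translate_of_pos (h' t (Metric.ball_subset_ball (min_le_right _ _) ht)) h1⟩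

theorem hasDerivAt_affine (c d t : ℝ) : HasDerivAt (fun s => c + s * d) d t := by
  simpa using ((hasDerivAt_id' t).mul_const d).const_add c

/-- The derivative of `t ↦ α(ℓ + t a, F + t h)(v)` for the potential form `α`. -/
theorem hasDerivAt_potentialForm (m : Trumpet) (w v : TrumpetTangent) :
    HasDerivAt (fun t => potentialForm (m.translate w t) v)
      ((2 * m.len * w.1) • (m.twist.der * v.2) + m.len ^ 2 • (w.2.D * v.2)
        - w.2.D * v.2.D.D * m.twist.derInv ^ 2).integral 0 := by
  obtain ⟨ε, hε, h⟩ := m.exists_ball_translate w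
  have key := hasDerivAt_intervalIntegral_of_continuousOn (a := 0) (b := 1) (t₀ := 0)
    (g := fun t x => (m.len + t * w.1) ^ 2 * ((m.twist.der x + t * w.2.D x) * v.2 x)
      + (m.twist.der x + t * w.2.D x)⁻¹ * v.2.D.D x)
    (g' := fun t x => 2 * (m.len + t * w.1) * w.1 * ((m.twist.der x + t * w.2.D x) * v.2 x)
      + (m.len + t * w.1) ^ 2 * (w.2.D x * v.2 x)
      - w.2.D x / (m.twist.der x + t * w.2.D x) ^ 2 * v.2.D.D x) hε ?_ ?_ ?_
  · refine (key.congr_of_eventuallyEq ?_).congr_deriv ?_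
    · filter_upwards [Metric.ball_mem_nhds (0 : ℝ) hε] with t ht
      obtain ⟨-, h1, h2⟩ := h t ht
      refine intervalIntegral.integral_congr fun x _ => ?_
      simp only [SmoothPer.add_apply, SmoothPer.smul_apply, SmoothPer.mul_apply,
        DiffCircle.derInv_apply, h1, h2]
    · refine intervalIntegral.integral_congr fun x _ => ?_
      simp only [SmoothPer.add_apply, SmoothPer.smul_apply, SmoothPer.mul_apply,
        SmoothPer.sub_apply, SmoothPer.pow_apply, DiffCircle.derInv_apply]
      ring
  · intro t ht
    have hne := fun x => ((h t ht).1 x).ne'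
    fun_prop (disch := assumption)
  · intro t ht x
    have hP := hasDerivAt_affine (m.twist.der x) (w.2.D x) t
    have hl := hasDerivAt_affine m.len w.1 t
    refine (((hl.fun_pow 2).mul (hP.mul_const (v.2 x))).add
      ((hP.fun_inv ((h t ht).1 x).ne').mul_const (v.2.D.D x))).congr_deriv ?_
    simp
    ring
  · have hne : ∀ z ∈ Metric.ball (0 : ℝ) ε ×ˢ (Set.univ : Set ℝ),
        (m.twist.der z.2 + z.1 * w.2.D z.2) ^ 2 ≠ 0 := fun z hz =>
      pow_ne_zero 2 ((h z.1 hz.1).1 z.2).ne'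
    unfold Function.uncurry
    fun_prop (disch := assumption)

/-- The integrand of the form `ω_N`. -/
noncomputable def omegaDensity (m : Trumpet) (v w : TrumpetTangent) : SmoothPer :=
  (m.len / 2) • (m.twist.der * (w.1 • v.2 - v.1 • w.2))
    - (m.len ^ 2 / 4) • (v.2.D * w.2 - w.2.D * v.2)
    + (1 / 4 : ℝ) • ((v.2.D * w.2.D.D - w.2.D * v.2.D.D) * m.twist.derInv ^ 2)

theorem omega_eq (m : Trumpet) (v w : TrumpetTangent) :
    omega m v w = (omegaDensity m v w).integral := by
  rw [omega, extDerivOne, dirDeriv, dirDeriv, (hasDerivAt_potentialForm m v w).deriv,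
    (hasDerivAt_potentialForm m w v).deriv, ← SmoothPer.integral_sub, ← SmoothPer.integral_smul]
  congr 1
  apply SmoothPer.ext'
  intro x
  simp [omegaDensity]
  ring

/-- The derivative of `ω_N(v, w)`, for constant vector fields `v, w`, along `t ↦ (ℓ + t a, F + t h)`. -/
theorem hasDerivAt_omega (m : Trumpet) (u v w : TrumpetTangent) :
    HasDerivAt (fun t => omega (m.translate u t) v w)
      ((1 / 2 : ℝ) • ((u.1 • m.twist.der + m.len • u.2.D) * (w.1 • v.2 - v.1 • w.2))
        - (m.len * u.1 / 2) • (v.2.D * w.2 - w.2.D * v.2)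
        - (1 / 2 : ℝ) • (u.2.D * (v.2.D * w.2.D.D - w.2.D * v.2.D.D)
          * m.twist.derInv ^ 3)).integral 0 := by
  obtain ⟨ε, hε, h⟩ := m.exists_ball_translate u
  have key := hasDerivAt_intervalIntegral_of_continuousOn (a := 0) (b := 1) (t₀ := 0)
    (g := fun t x => (m.len + t * u.1) / 2 * ((m.twist.der x + t * u.2.D x)
        * (w.1 * v.2 x - v.1 * w.2 x))
      - (m.len + t * u.1) ^ 2 / 4 * (v.2.D x * w.2 x - w.2.D x * v.2 x)
      + 1 / 4 * ((v.2.D x * w.2.D.D x - w.2.D x * v.2.D.D x)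
        * (m.twist.der x + t * u.2.D x)⁻¹ ^ 2))
    (g' := fun t x => (u.1 / 2 * (m.twist.der x + t * u.2.D x) + (m.len + t * u.1) / 2 * u.2.D x)
        * (w.1 * v.2 x - v.1 * w.2 x)
      - (m.len + t * u.1) * u.1 / 2 * (v.2.D x * w.2 x - w.2.D x * v.2 x)
      - 1 / 2 * ((v.2.D x * w.2.D.D x - w.2.D x * v.2.D.D x)
        * (m.twist.der x + t * u.2.D x)⁻¹ ^ 3 * u.2.D x)) hε ?_ ?_ ?_
  · refine (key.congr_of_eventuallyEq ?_).congr_deriv ?_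
    · filter_upwards [Metric.ball_mem_nhds (0 : ℝ) hε] with t ht
      obtain ⟨-, h1, h2⟩ := h t ht
      rw [omega_eq]
      refine intervalIntegral.integral_congr fun x _ => ?_
      simp only [omegaDensity, SmoothPer.add_apply, SmoothPer.smul_apply, SmoothPer.mul_apply,
        SmoothPer.sub_apply, SmoothPer.pow_apply, DiffCircle.derInv_apply, h1, h2]
    · refine intervalIntegral.integral_congr fun x _ => ?_
      simp only [SmoothPer.add_apply, SmoothPer.smul_apply, SmoothPer.mul_apply,
        SmoothPer.sub_apply, SmoothPer.pow_apply, DiffCircle.derInv_apply]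
      ring
  · intro t ht
    have hne := fun x => ((h t ht).1 x).ne'
    fun_prop (disch := assumption)
  · intro t ht x
    have hP := hasDerivAt_affine (m.twist.der x) (u.2.D x) t
    have hl := hasDerivAt_affine m.len u.1 t
    have hne := ((h t ht).1 x).ne'
    refine ((((hl.div_const 2).mul (hP.mul_const (w.1 * v.2 x - v.1 * w.2 x))).sub
      (((hl.fun_pow 2).div_const 4).mul_const (v.2.D x * w.2 x - w.2.D x * v.2 x))).add
      ((((hP.fun_inv hne).fun_pow 2).const_mul
        (v.2.D x * w.2.D.D x - w.2.D x * v.2.D.D x)).const_mul (1 / 4))).congr_deriv ?_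
    simp
    field_simp
    ring
  · have hne : ∀ z ∈ Metric.ball (0 : ℝ) ε ×ˢ (Set.univ : Set ℝ),
        (m.twist.der z.2 + z.1 * u.2.D z.2) ≠ 0 := fun z hz =>
      ((h z.1 hz.1).1 z.2).ne'
    unfold Function.uncurry
    fun_prop (disch := assumption)

/-- The three integrands already cancel pointwise under cyclic permutation of `u, v, w`. -/
theorem omega_closed (m : Trumpet) (u v w : TrumpetTangent) : extDerivTwo omega m u v w = 0 := by
  rw [extDerivTwo, dirDeriv, dirDeriv, dirDeriv, (hasDerivAt_omega m u v w).deriv,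
    (hasDerivAt_omega m v w u).deriv, (hasDerivAt_omega m w u v).deriv,
    ← SmoothPer.integral_add, ← SmoothPer.integral_add, ← SmoothPer.integral_zero]
  congr 1
  apply SmoothPer.ext'
  intro x
  simp
  ring

end Trumpet

/-! ### The coadjoint action, the stabilizer of `L(ℓ)`, and variations of Hill operators. -/

/-- The cocycle property of the Schwarzian says exactly that `(F, μ) ↦ F⁻¹ · μ` is a right action.
-/
theorem coadInv_mul (F G : DiffCircle) (μ : VirDual) :
    coadInv (F * G) μ = coadInv G (coadInv F μ) := by
  refine Prod.ext ?_ rfl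
  apply SmoothPer.ext'
  intro x
  simp only [coadInv, der_mul, schwarzian_mul, pull_mul_left, pull_add, pull_mul, pull_pow,
    pull_smul, SmoothPer.add_apply, SmoothPer.mul_apply, SmoothPer.smul_apply,
    SmoothPer.pow_apply]
  ring

theorem coadInv_neg (F : DiffCircle) (μ : VirDual) : coadInv F (-μ) = -coadInv F μ := by
  refine Prod.ext ?_ rfl
  apply SmoothPer.ext'
  intro x
  simp [coadInv]
  ring

theorem schwarzian_one : (1 : DiffCircle).schwarzian = 0 := by
  simp [schwarzian]

theorem coadInv_one (μ : VirDual) : coadInv 1 μ = μ := by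
  refine Prod.ext ?_ rfl
  simp [coadInv, schwarzian_one]

theorem coadInv_hillPotential (F : DiffCircle) (ℓ : ℝ) :
    coadInv F (hill (Trumpet.hillPotential ℓ)) =
      ((-(ℓ ^ 2) / 4) • F.der ^ 2 + (1 / 2 : ℝ) • F.schwarzian, 1) := by
  refine Prod.ext ?_ rfl
  apply SmoothPer.ext'
  intro x
  simp [coadInv, hill, Trumpet.hillPotential]
  ring

/-- The stabilizer of `d²/dx² - ℓ²/4` consists of rotations. -/
theorem der_eq_one_of_coadInv_hill_eq {ℓ : ℝ} (hℓ : 0 < ℓ) {F : DiffCircle}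
    (h : coadInv F (hill (Trumpet.hillPotential ℓ)) = hill (Trumpet.hillPotential ℓ)) :
    F.der = 1 := by
  rw [coadInv_hillPotential] at h
  have h1 := congrArg Prod.fst h
  have hx : ∀ x, -(ℓ ^ 2) / 4 * F.der x ^ 2 + 1 / 2 * F.schwarzian x = -(ℓ ^ 2) / 4 :=
    fun x => congrArg (fun f : SmoothPer => f x) h1
  -- With `u = F''/F'` one has `S(F) = u' - u²/2`, so the stabilizer equation reads `u² + ℓ² (F'² -
  -- 1) = 2u'`. Integrating it and using `∫ F' = 1` replaces `F'² - 1` by `(F' - 1)²`.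
  have e : ((F.der.D * F.derInv) ^ 2 + ℓ ^ 2 • (F.der - 1) ^ 2).integral = 0 := by
    have e1 : ((F.der.D * F.derInv) ^ 2 + ℓ ^ 2 • (F.der - 1) ^ 2).integral
        = ((2 * ℓ ^ 2) • (1 - F.der)).integral := by
      apply SmoothPer.integral_eq_of_sub_eq_D (h := (2 : ℝ) • (F.der.D * F.derInv))
      apply SmoothPer.ext'
      intro x
      have hp := (F.der_pos x).ne'
      have := hx x
      simp only [schwarzian, SmoothPer.D_smul, SmoothPer.D_mul, D_derInv, SmoothPer.add_apply,
        SmoothPer.sub_apply, SmoothPer.neg_apply,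
        SmoothPer.mul_apply, SmoothPer.smul_apply, SmoothPer.pow_apply, SmoothPer.one_apply,
        derInv_apply] at this ⊢
      linear_combination (-4) * this
    rw [e1]
    simp
  have e2 := SmoothPer.eq_zero_of_integral_eq_zero (fun x => by
    simp only [SmoothPer.add_apply, SmoothPer.pow_apply, SmoothPer.smul_apply]; positivity) e
  apply SmoothPer.ext'
  intro x
  have h2 : (F.der.D x * F.derInv x) ^ 2 + ℓ ^ 2 * (F.der x - 1) ^ 2 = 0 :=
    congrArg (fun f : SmoothPer => f x) e2
  have h3 : (ℓ * (F.der x - 1)) ^ 2 = 0 := by nlinarith [sq_nonneg (F.der.D x * F.derInv x)]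
  have h4 := (mul_eq_zero.1 (pow_eq_zero_iff two_ne_zero |>.1 h3)).resolve_left hℓ.ne'
  simp only [SmoothPer.one_apply]
  linarith

/-- Holds because the potential is constant. It makes `Ψ` independent of the representative of an
`S¹`-orbit. -/
theorem coadInv_eq_of_der_eq {F G : DiffCircle} (h : F.der = G.der) (ℓ : ℝ) :
    coadInv F (hill (Trumpet.hillPotential ℓ)) = coadInv G (hill (Trumpet.hillPotential ℓ)) := by
  rw [coadInv_hillPotential, coadInv_hillPotential, schwarzian_eq_of_der_eq h, h]

/-- The fibres of `F ↦ F⁻¹ · L(ℓ)` are the orbits of the rotations. -/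
theorem exists_rotation_of_coadInv_hill_eq {ℓ : ℝ} (hℓ : 0 < ℓ) {F G : DiffCircle}
    (h : coadInv F (hill (Trumpet.hillPotential ℓ)) = coadInv G (hill (Trumpet.hillPotential ℓ))) :
    ∃ t : UnitAddCircle, rotation t * G = F := by
  -- Equal values put `F G⁻¹` in the stabilizer of `L(ℓ)`.
  have h1 : (F * G⁻¹).der = 1 := der_eq_one_of_coadInv_hill_eq hℓ (by
    rw [coadInv_mul, h, ← coadInv_mul, mul_inv_cancel, coadInv_one])
  exact ⟨_, by rw [← eq_rotation_of_der_eq_one h1, inv_mul_cancel_right]⟩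

@[simp] theorem der_rotation_mul (t : UnitAddCircle) (F : DiffCircle) :
    (rotation t * F).der = F.der := by
  rw [der_mul, der_rotation, pull_one, one_mul]

/-- The variation of `F⁻¹ · L(ℓ)` under a variation `h` of `F`. -/
noncomputable def hillVariation (ℓ : ℝ) (F : DiffCircle) : SmoothPer →ₗ[ℝ] SmoothPer where
  -- With `u = F''/F'`, the variation of `u` is `δu = (h'/F')'`, and `S(F) = u' - u²/2` varies by
  -- `(δu)' - u δu`.
  toFun h := (-(ℓ ^ 2) / 2) • (F.der * h.D) + (1 / 2 : ℝ) •
    ((h.D * F.derInv).D.D - F.der.D * F.derInv * (h.D * F.derInv).D)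
  map_add' f g := by
    apply SmoothPer.ext'
    intro x
    simp
    ring
  map_smul' c f := by
    apply SmoothPer.ext'
    intro x
    simp
    ring

theorem hillVariation_apply (ℓ : ℝ) (F : DiffCircle) (h : SmoothPer) :
    hillVariation ℓ F h = (-(ℓ ^ 2) / 2) • (F.der * h.D) + (1 / 2 : ℝ) •
      ((h.D * F.derInv).D.D - F.der.D * F.derInv * (h.D * F.derInv).D) := rfl

theorem hillVariation_eq_of_der_eq {F G : DiffCircle} (h : F.der = G.der) (ℓ : ℝ) :
    hillVariation ℓ F = hillVariation ℓ G := by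
  ext1 f
  rw [hillVariation_apply, hillVariation_apply, derInv_eq_of_der_eq h, h]

theorem hillVariation_one (ℓ : ℝ) (F : DiffCircle) : hillVariation ℓ F 1 = 0 := by
  simp [hillVariation_apply]

/-- Infinitesimal equivariance of `F ↦ F⁻¹ · L(ℓ)`: the generating vector `-F'f` goes to the
generating vector on the orbit. -/
theorem hillVariation_generator (ℓ : ℝ) (F : DiffCircle) (f : SmoothPer) :
    hillVariation ℓ F (-(F.der * f)) =
      coadGenerator f (coadInv F (hill (Trumpet.hillPotential ℓ))) := by
  apply SmoothPer.ext'
  intro x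
  have hp := (F.der_pos x).ne'
  simp only [hillVariation_apply, coadInv_hillPotential, coadGenerator, schwarzian,
    SmoothPer.D_smul, SmoothPer.D_mul, SmoothPer.D_neg, SmoothPer.D_add, SmoothPer.D_sub,
    sq, D_derInv, SmoothPer.add_apply,
    SmoothPer.sub_apply, SmoothPer.neg_apply,
    SmoothPer.mul_apply, SmoothPer.smul_apply, derInv_apply]
  field_simp
  ring

/-- The infinitesimal coadjoint action is dual to the bracket. All derivatives of `T`, and three
derivatives of `g`, are moved by parts; the cubic term produces the Virasoro cocycle. -/
theorem kks_eq (f g T : SmoothPer) :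
    (coadGenerator g (hill T) * f).integral = -kks (hill T) f g := by
  have h : (coadGenerator g (hill T) * f).integral
      = (-(T * (f * g.D - f.D * g)) + (1 / 2 : ℝ) • (f.D.D.D * g)).integral := by
    apply SmoothPer.integral_eq_of_sub_eq_D
      (h := -(f * g * T) - (1 / 2 : ℝ) • (f * g.D.D - f.D * g.D + f.D.D * g))
    apply SmoothPer.ext'
    intro x
    simp [coadGenerator, hill]
    ring
  rw [h, kks, virPairing, virBracket]
  simp [hill]
  ring

/-- Infinitesimal transitivity on `Diff_o(S¹)`: the variation `h` is the generating vector of `f =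
-h/F'`. -/
theorem neg_der_mul_neg_derInv_mul (F : DiffCircle) (h : SmoothPer) :
    -(F.der * -(F.derInv * h)) = h := by
  refine SmoothPer.ext' fun x => ?_
  have hp := (F.der_pos x).ne'
  simp only [SmoothPer.neg_apply, SmoothPer.mul_apply, derInv_apply]
  field_simp

/-! ### The moment maps, invariance, nondegeneracy and uniqueness of `ω_N`. -/

namespace Trumpet

/-- The numbers `Pᵢ` and `kᵢ` stand for values at one point of `F', F'', F'''` and `h', h'', h'''`.
General `t` is needed because differentiation under the integral uses the derivative on a whole
interval. -/
theorem schwarzian_translate_hasDerivAt {P₀ P₁ P₂ k₁ k₂ k₃ t : ℝ} (h : P₀ + t * k₁ ≠ 0) :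
    HasDerivAt (fun t => (P₂ + t * k₃) * (P₀ + t * k₁)⁻¹
        - 3 / 2 * ((P₁ + t * k₂) * (P₀ + t * k₁)⁻¹) ^ 2)
      (k₃ * (P₀ + t * k₁)⁻¹ - (P₂ + t * k₃) * k₁ * (P₀ + t * k₁)⁻¹ ^ 2
        - 3 * ((P₁ + t * k₂) * (P₀ + t * k₁)⁻¹) *
          (k₂ * (P₀ + t * k₁)⁻¹ - (P₁ + t * k₂) * k₁ * (P₀ + t * k₁)⁻¹ ^ 2)) t := by
  have hi := (hasDerivAt_affine P₀ k₁ t).fun_inv h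
  refine (((hasDerivAt_affine P₂ k₃ t).mul hi).sub
    ((((hasDerivAt_affine P₁ k₂ t).mul hi).fun_pow 2).const_mul (3 / 2))).congr_deriv ?_
  simp
  field_simp
  ring

/-- The derivative of `F⁻¹ · L(ℓ)` along a variation of `F`, at a point of the circle. -/
theorem hasDerivAt_coadInv_translate (m : Trumpet) (h : SmoothPer) (x : ℝ) :
    HasDerivAt (fun t => (coadInv (m.translate (0, h) t).twist (hill (hillPotential m.len))).1 x)
      (hillVariation m.len m.twist h x) 0 := by
  obtain ⟨ε, hε, hb⟩ := m.exists_ball_translate (0, h)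
  have hp := (m.twist.der_pos x).ne'
  have h1 := ((((hasDerivAt_affine (m.twist.der x) (h.D x) 0).fun_pow 2).const_mul
    (-(m.len ^ 2) / 4)).fun_add ((schwarzian_translate_hasDerivAt (P₀ := m.twist.der x)
      (P₁ := m.twist.der.D x) (P₂ := m.twist.der.D.D x) (k₁ := h.D x) (k₂ := h.D.D x)
      (k₃ := h.D.D.D x) (t := 0) (by simpa using hp)).const_mul (1 / 2)))
  refine (h1.congr_of_eventuallyEq ?_).congr_deriv ?_
  · filter_upwards [Metric.ball_mem_nhds (0 : ℝ) hε] with t ht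
    obtain ⟨-, -, h2⟩ := hb t ht
    rw [coadInv_hillPotential]
    simp only [schwarzian, SmoothPer.D_smul, SmoothPer.D_add, SmoothPer.add_apply,
      SmoothPer.sub_apply, SmoothPer.mul_apply, SmoothPer.smul_apply, SmoothPer.pow_apply,
      derInv_apply, h2]
  · simp only [hillVariation_apply, SmoothPer.D_mul, SmoothPer.D_neg, SmoothPer.D_add,
      sq, D_derInv, SmoothPer.add_apply,
      SmoothPer.sub_apply, SmoothPer.neg_apply,
      SmoothPer.mul_apply, SmoothPer.smul_apply, derInv_apply]
    simp
    field_simp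
    ring

/-- The moment map identity for the `Diff_o(S¹)`-action, in terms of the variation of the
Hill operator. -/
theorem integral_momentVariation (m : Trumpet) (f : SmoothPer) (w : TrumpetTangent) :
    ((m.len * w.1 / 2) • (m.twist.der ^ 2 * f) - hillVariation m.len m.twist w.2 * f).integral
      = -omega m (diffGenerator f m) w := by
  rw [omega_eq, ← SmoothPer.integral_neg]
  -- Put `A = (F'f)'/F'` and `B = w.2'/F'`. One integration by parts turns the Schwarzian part into
  -- `½ A B'`, and `½ A B' = ¼ (AB)' + ¼ (AB' - A'B)`, whose last term is the one in `ω_N`. The `ℓ²`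
  -- term is antisymmetrized in the same way.
  apply SmoothPer.integral_eq_of_sub_eq_D (h :=
    (m.len ^ 2 / 4) • (m.twist.der * f * w.2)
      - (1 / 2 : ℝ) • (f * (w.2.D * m.twist.derInv).D)
      + (1 / 4 : ℝ) • (w.2.D * m.twist.derInv * ((m.twist.der * f).D * m.twist.derInv)))
  apply SmoothPer.ext'
  intro x
  have hp := (m.twist.der_pos x).ne'
  simp only [hillVariation_apply, omegaDensity, diffGenerator,
    SmoothPer.D_smul, SmoothPer.D_mul, SmoothPer.D_neg, SmoothPer.D_add, SmoothPer.D_sub,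
    sq, D_derInv, SmoothPer.add_apply,
    SmoothPer.sub_apply, SmoothPer.neg_apply,
    SmoothPer.mul_apply, SmoothPer.smul_apply, derInv_apply]
  field_simp
  ring

theorem hasDerivAt_diffMoment (f : SmoothPer) (m : Trumpet) (w : TrumpetTangent) :
    HasDerivAt (fun t => virPairing (diffMoment (m.translate w t)) (f, 0))
      (-omega m (diffGenerator f m) w) 0 := by
  rw [← integral_momentVariation]
  obtain ⟨ε, hε, h⟩ := m.exists_ball_translate w
  have key := hasDerivAt_intervalIntegral_of_continuousOn (a := 0) (b := 1) (t₀ := 0)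
    (g := fun t x => ((m.len + t * w.1) ^ 2 / 4 * (m.twist.der x + t * w.2.D x) ^ 2
      - 1 / 2 * ((m.twist.der.D.D x + t * w.2.D.D.D x) * (m.twist.der x + t * w.2.D x)⁻¹
        - 3 / 2 * ((m.twist.der.D x + t * w.2.D.D x) * (m.twist.der x + t * w.2.D x)⁻¹) ^ 2))
      * f x)
    (g' := fun t x => ((m.len + t * w.1) * w.1 / 2 * (m.twist.der x + t * w.2.D x) ^ 2
      + (m.len + t * w.1) ^ 2 / 2 * (m.twist.der x + t * w.2.D x) * w.2.D x
      - 1 / 2 * (w.2.D.D.D x * (m.twist.der x + t * w.2.D x)⁻¹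
        - (m.twist.der.D.D x + t * w.2.D.D.D x) * w.2.D x * (m.twist.der x + t * w.2.D x)⁻¹ ^ 2
        - 3 * ((m.twist.der.D x + t * w.2.D.D x) * (m.twist.der x + t * w.2.D x)⁻¹) *
          (w.2.D.D x * (m.twist.der x + t * w.2.D x)⁻¹
            - (m.twist.der.D x + t * w.2.D.D x) * w.2.D x
              * (m.twist.der x + t * w.2.D x)⁻¹ ^ 2))) * f x) hε ?_ ?_ ?_
  · refine (key.congr_of_eventuallyEq ?_).congr_deriv ?_
    · filter_upwards [Metric.ball_mem_nhds (0 : ℝ) hε] with t ht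
      obtain ⟨-, h1, h2⟩ := h t ht
      rw [virPairing, mul_zero, add_zero]
      refine intervalIntegral.integral_congr fun x _ => ?_
      simp only [diffMoment, coadInv_hillPotential, schwarzian, Prod.fst_neg, SmoothPer.D_smul,
        SmoothPer.D_add, SmoothPer.add_apply, SmoothPer.neg_apply,
        SmoothPer.sub_apply, SmoothPer.mul_apply, SmoothPer.smul_apply, SmoothPer.pow_apply,
        derInv_apply, h1, h2]
      ring
    · refine intervalIntegral.integral_congr fun x _ => ?_
      have hp := (m.twist.der_pos x).ne'
      simp only [hillVariation_apply, SmoothPer.D_mul, SmoothPer.D_neg, SmoothPer.D_add,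
        sq, D_derInv, SmoothPer.add_apply,
        SmoothPer.sub_apply, SmoothPer.neg_apply,
        SmoothPer.mul_apply, SmoothPer.smul_apply, derInv_apply]
      simp only [zero_mul, add_zero]
      field_simp
      ring
  · intro t ht
    have hne := fun x => ((h t ht).1 x).ne'
    fun_prop (disch := assumption)
  · intro t ht x
    have hP := hasDerivAt_affine (m.twist.der x) (w.2.D x) t
    have hl := hasDerivAt_affine m.len w.1 t
    have hS := schwarzian_translate_hasDerivAt (P₁ := m.twist.der.D x) (P₂ := m.twist.der.D.D x)
      (k₂ := w.2.D.D x) (k₃ := w.2.D.D.D x) ((h t ht).1 x).ne'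
    refine (((((hl.fun_pow 2).div_const 4).mul (hP.fun_pow 2)).sub
      (hS.const_mul (1 / 2))).mul_const (f x)).congr_deriv ?_
    congr 1
    simp
    ring
  · have hne : ∀ z ∈ Metric.ball (0 : ℝ) ε ×ˢ (Set.univ : Set ℝ),
        (m.twist.der z.2 + z.1 * w.2.D z.2) ≠ 0 := fun z hz =>
      ((h z.1 hz.1).1 z.2).ne'
    unfold Function.uncurry
    fun_prop (disch := assumption)

theorem hasDerivAt_circleMoment (m : Trumpet) (w : TrumpetTangent) :
    HasDerivAt (fun t => circleMoment (m.translate w t)) (m.len * w.1 / 2) 0 := by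
  obtain ⟨ε, hε, h⟩ := m.exists_ball_translate w
  refine ((((hasDerivAt_affine m.len w.1 0).fun_pow 2).div_const 4).congr_of_eventuallyEq
    ?_).congr_deriv ?_
  · filter_upwards [Metric.ball_mem_nhds (0 : ℝ) hε] with t ht
    rw [circleMoment, (h t ht).2.1]
  · simp
    ring

theorem omega_circleGenerator (m : Trumpet) (w : TrumpetTangent) :
    omega m circleGenerator w = -(m.len * w.1 / 2) := by
  have e : omega m circleGenerator w = ((-(m.len * w.1 / 2)) • m.twist.der).integral := by
    rw [omega_eq]
    apply SmoothPer.integral_eq_of_sub_eq_D (h := -(m.len ^ 2 / 4) • w.2)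
    apply SmoothPer.ext'
    intro x
    simp [omegaDensity, circleGenerator]
    ring
  rw [e]
  simp

theorem omega_eq_of_der_eq {m m' : Trumpet} (h1 : m.len = m'.len)
    (h2 : m.twist.der = m'.twist.der) (v w : TrumpetTangent) : omega m v w = omega m' v w := by
  rw [omega_eq, omega_eq, omegaDensity, omegaDensity, derInv_eq_of_der_eq h2, h2, h1]

theorem omega_vadd (t : UnitAddCircle) (m : Trumpet) (v w : TrumpetTangent) :
    omega (t +ᵥ m) v w = omega m v w :=
  omega_eq_of_der_eq (m := t +ᵥ m) (m' := m) rfl (der_rotation_mul t m.twist) v w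

/-- The integrand transforms as a density under reparametrization: terms with the second derivative
of `F⁻¹` cancel by antisymmetry. The change of variables formula concludes. -/
theorem omega_smul (F : DiffCircle) (m : Trumpet) (v w : TrumpetTangent) :
    omega (F • m) (diffTangent F v) (diffTangent F w) = omega m v w := by
  rw [omega_eq, omega_eq, ← integral_pull_mul_der F⁻¹ (omegaDensity m v w)]
  congr 1
  apply SmoothPer.ext'
  intro x
  have hp := ((F⁻¹).der_pos x).ne'
  have e1 : (F • m).twist = m.twist * F⁻¹ := rfl
  have e2 : (F • m).len = m.len := rfl
  simp only [omegaDensity, diffTangent, e1, e2, der_mul, derInv_mul, pull_add, pull_sub, pull_mul,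
    pull_smul, pull_pow, D_pull, SmoothPer.D_mul, SmoothPer.add_apply,
    SmoothPer.sub_apply, SmoothPer.mul_apply, SmoothPer.smul_apply, SmoothPer.pow_apply]
  rw [derInv_apply]
  field_simp
  ring

theorem omega_add_left (m : Trumpet) (u v w : TrumpetTangent) :
    omega m (u + v) w = omega m u w + omega m v w := by
  rw [omega_eq, omega_eq, omega_eq, ← SmoothPer.integral_add]
  congr 1
  apply SmoothPer.ext'
  intro x
  simp [omegaDensity]
  ring

theorem omega_smul_left (m : Trumpet) (c : ℝ) (v w : TrumpetTangent) :
    omega m (c • v) w = c * omega m v w := by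
  rw [omega_eq, omega_eq, ← SmoothPer.integral_smul]
  congr 1
  apply SmoothPer.ext'
  intro x
  simp [omegaDensity]
  ring

theorem omega_swap (m : Trumpet) (v w : TrumpetTangent) : omega m v w = -omega m w v := by
  rw [omega_eq, omega_eq, ← SmoothPer.integral_neg]
  congr 1
  apply SmoothPer.ext'
  intro x
  simp [omegaDensity]
  ring

theorem omega_self (m : Trumpet) (v : TrumpetTangent) : omega m v v = 0 := by
  linarith [omega_swap m v v]

/-- A variation of `F` in the kernel of the restriction of `ω_N` to a level set of `ℓ` is
constant. -/
theorem D_eq_zero_of_omega_eq_zero (m : Trumpet) (h : SmoothPer)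
    (h0 : ∀ k, omega m (0, h) (0, k) = 0) : h.D = 0 := by
  -- As a vector field on the target, `v` is the derivative of `h ∘ F⁻¹`. Pairing with it makes
  -- `ω_N` negative semidefinite: `-½ ∫ (ℓ² F' v² + v'²/F')`.
  set v := h.D * m.twist.derInv with hv
  have e : omega m (0, h) (0, v) =
      (-(1 / 2 : ℝ) • (m.len ^ 2 • (m.twist.der * v ^ 2) + v.D ^ 2 * m.twist.derInv)).integral := by
    rw [omega_eq]
    apply SmoothPer.integral_eq_of_sub_eq_D (h := (m.len ^ 2 / 4) • (h * v) +
      (1 / 4 : ℝ) • (v.D * m.twist.derInv * v))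
    apply SmoothPer.ext'
    intro x
    have hp := (m.twist.der_pos x).ne'
    have hh : h.D = m.twist.der * v := by
      rw [hv, mul_comm h.D, ← mul_assoc, der_mul_derInv, one_mul]
    simp only [omegaDensity, hh, SmoothPer.D_smul, SmoothPer.D_mul, SmoothPer.D_add,
      D_derInv, SmoothPer.add_apply, SmoothPer.sub_apply, SmoothPer.neg_apply,
      SmoothPer.mul_apply, SmoothPer.smul_apply, SmoothPer.pow_apply, derInv_apply]
    field_simp
    ring
  rw [h0, SmoothPer.integral_smul] at e
  have hpos : ∀ x, 0 < m.twist.derInv x := fun x => inv_pos.2 (m.twist.der_pos x)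
  have e2 := SmoothPer.eq_zero_of_integral_eq_zero (fun x => by
    have := m.twist.der_pos x
    have := hpos x
    simp only [SmoothPer.add_apply, SmoothPer.pow_apply, SmoothPer.smul_apply,
      SmoothPer.mul_apply]
    positivity) (by linarith : (m.len ^ 2 • (m.twist.der * v ^ 2)
      + v.D ^ 2 * m.twist.derInv).integral = 0)
  apply SmoothPer.ext'
  intro x
  have e3 : m.len ^ 2 * (m.twist.der x * v x ^ 2) + v.D x ^ 2 * m.twist.derInv x = 0 :=
    congrArg (fun f : SmoothPer => f x) e2
  have hl := m.len_pos
  have hp := m.twist.der_pos x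
  have h4 : 0 ≤ v.D x ^ 2 * m.twist.derInv x := mul_nonneg (sq_nonneg _) (hpos x).le
  have h5 : 0 ≤ m.len ^ 2 * (m.twist.der x * v x ^ 2) := by positivity
  have h6 : m.len ^ 2 * (m.twist.der x * v x ^ 2) = 0 := by linarith
  have h7 : v x = 0 := by simpa [hl.ne', hp.ne'] using h6
  have h8 : h.D x * m.twist.derInv x = 0 := h7
  simpa [(hpos x).ne'] using h8

/-- Pairing with the circle generator forces `dℓ = 0`, pairing with variations of `F` makes `dF`
constant, and pairing with `∂_ℓ` kills that constant because `∫ F' = 1`. -/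
theorem omega_nondegenerate (m : Trumpet) (v : TrumpetTangent) (h0 : ∀ w, omega m v w = 0) :
    v = 0 := by
  have ha : v.1 = 0 := by
    have h1 := omega_swap m circleGenerator v
    rw [h0, omega_circleGenerator] at h1
    have := m.len_pos.ne'
    simpa [this] using h1
  have hv : v = (0, v.2) := Prod.ext ha rfl
  have hD : v.2.D = 0 := D_eq_zero_of_omega_eq_zero m v.2 fun k => by rw [← hv]; exact h0 _
  have h1 := h0 (1, 0)
  rw [hv, omega_eq, omegaDensity, SmoothPer.eq_const_of_D_eq_zero hD] at h1
  have h2 : v.2 0 = 0 := by simpa [m.len_pos.ne'] using h1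
  refine Prod.ext ha ?_
  rw [SmoothPer.eq_const_of_D_eq_zero hD, h2, zero_smul]
  rfl

theorem coad_diffMoment (F : DiffCircle) (m : Trumpet) :
    diffMoment (F • m) = coad F (diffMoment m) := by
  rw [coad, diffMoment, diffMoment, coadInv_neg, ← coadInv_mul]
  rfl

/-- A two-form is determined by the moment map condition for the `Diff_o(S¹)`-action. -/
theorem eq_omega_of_isDiffHamiltonian (Ω : Trumpet → TrumpetTangent → TrumpetTangent → ℝ)
    (hΩ : IsDiffHamiltonian Ω diffMoment (-1)) : Ω = omega := by
  have hΩ2 := hΩ.symplectic.isTwoForm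
  -- Both forms give the derivative of the same moment map, and every `(0, h)` is a generating
  -- vector.
  have hvert : ∀ m h w, Ω m (0, h) w = omega m (0, h) w := fun m h w => by
    have e := (hΩ.momentMap.moment (-(m.twist.derInv * h)) m w).unique
      (hasDerivAt_diffMoment (-(m.twist.derInv * h)) m w)
    have e2 : diffGenerator (-(m.twist.derInv * h)) m = (0, h) := by
      rw [diffGenerator, neg_der_mul_neg_derInv_mul]
    rw [e2] at e
    linarith
  have hswap : ∀ m v w, Ω m v w = -Ω m w v := fun m v w => by
    have h1 := hΩ2.alternating m (v + w)
    rw [(hΩ2.linear_right m (v + w)).map_add, (hΩ2.linear_left m v).map_add,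
      (hΩ2.linear_left m w).map_add, hΩ2.alternating, hΩ2.alternating] at h1
    linarith
  funext m v w
  have hv : v = v.1 • ((1, 0) : TrumpetTangent) + (0, v.2) := by ext1 <;> simp
  have hw : w = w.1 • ((1, 0) : TrumpetTangent) + (0, w.2) := by ext1 <;> simp
  -- Modulo variations of `F`, only `∂_ℓ` paired with itself remains, and this vanishes by
  -- alternation.
  have h1 : Ω m (1, 0) w = omega m (1, 0) w := by
    rw [hswap, omega_swap, hw, (hΩ2.linear_left m _).map_add, (hΩ2.linear_left m _).map_smul,
      hΩ2.alternating, omega_add_left, omega_smul_left, omega_self, hvert]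
    simp
  rw [hv, (hΩ2.linear_left m _).map_add, (hΩ2.linear_left m _).map_smul, omega_add_left,
    omega_smul_left, hvert, h1]
  rfl

end Trumpet

/-! ### Smooth dependence on parameters. -/

open MeasureTheory in
theorem hasFDerivAt_intervalIntegral_of_contDiff {E : Type*} [NormedAddCommGroup E]
    [NormedSpace ℝ E] [ProperSpace E] {f : E × ℝ → ℝ} (hf : ContDiff ℝ 1 f) (a b : ℝ) (u : E) :
    HasFDerivAt (fun u => ∫ x in a..b, f (u, x))
      (∫ x in a..b, (fderiv ℝ f (u, x)).comp (ContinuousLinearMap.inl ℝ E ℝ)) u := by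
  have hc : Continuous fun z : E × ℝ => (fderiv ℝ f z).comp (ContinuousLinearMap.inl ℝ E ℝ) :=
    (hf.continuous_fderiv one_ne_zero).clm_comp continuous_const
  obtain ⟨C, hC⟩ := ((isCompact_closedBall u 1).prod
    (isCompact_uIcc (a := a) (b := b))).exists_bound_of_continuousOn hc.continuousOn
  have hfc := hf.continuous
  refine intervalIntegral.hasFDerivAt_integral_of_dominated_of_fderiv_le
    (F := fun u x => f (u, x))
    (F' := fun u x => (fderiv ℝ f (u, x)).comp (ContinuousLinearMap.inl ℝ E ℝ))
    (bound := fun _ => C) (Metric.closedBall_mem_nhds u one_pos) ?_ ?_ ?_ ?_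
    intervalIntegrable_const ?_
  · exact Filter.Eventually.of_forall fun v =>
      (hfc.comp (by fun_prop : Continuous fun x : ℝ => (v, x))).aestronglyMeasurable
  · exact (hfc.comp (by fun_prop : Continuous fun x : ℝ => (u, x))).intervalIntegrable _ _
  · exact (hc.comp (by fun_prop : Continuous fun x : ℝ => (u, x))).aestronglyMeasurable
  · exact Filter.Eventually.of_forall fun x hx v hv =>
      hC (v, x) ⟨hv, Set.uIoc_subset_uIcc hx⟩
  · exact Filter.Eventually.of_forall fun x _ v _ =>
      ((hf.differentiable one_ne_zero (v, x)).hasFDerivAt).comp v (hasFDerivAt_prodMk_left v x)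

/-- Integrals of smooth functions depend smoothly on parameters. -/
theorem ContDiff.intervalIntegral_right {E : Type*} [NormedAddCommGroup E]
    [NormedSpace ℝ E] [FiniteDimensional ℝ E] {f : E × ℝ → ℝ} {n : ℕ} (hf : ContDiff ℝ n f)
    (a b : ℝ) : ContDiff ℝ n (fun u => ∫ x in a..b, f (u, x)) := by
  have : ProperSpace E := FiniteDimensional.proper_real E
  induction n generalizing f with
  | zero =>
    refine contDiff_zero.2 ?_
    exact intervalIntegral.continuous_parametric_intervalIntegral_of_continuous'
      (f := fun u x => f (u, x)) hf.continuous a b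
  | succ n ih =>
    have h1 : ContDiff ℝ 1 f := hf.of_le (by exact_mod_cast Nat.le_add_left 1 n)
    have hd := hasFDerivAt_intervalIntegral_of_contDiff h1 a b
    push_cast at hf ⊢
    -- In finite dimension it suffices to treat each directional derivative, which is again a
    -- parameter integral, of `∂_y f`; this is why the induction generalizes `f`.
    refine contDiff_succ_iff_fderiv_apply.2
      ⟨fun u => (hd u).differentiableAt, by simp, fun y => ?_⟩
    have e : (fun u => fderiv ℝ (fun u => ∫ x in a..b, f (u, x)) u y) =
        fun u => ∫ x in a..b, fderiv ℝ f (u, x) (y, 0) := by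
      funext u
      have hc : Continuous fun x : ℝ =>
          (fderiv ℝ f (u, x)).comp (ContinuousLinearMap.inl ℝ E ℝ) :=
        ((h1.continuous_fderiv one_ne_zero).comp (by fun_prop)).clm_comp continuous_const
      rw [(hd u).fderiv, ContinuousLinearMap.intervalIntegral_apply (hc.intervalIntegrable _ _)]
      rfl
    rw [e]
    refine ih (f := fun z => fderiv ℝ f z (y, 0)) ?_
    exact (contDiff_succ_iff_fderiv.1 hf).2.2.clm_apply contDiff_const

/-- The inverse of a smooth family of increasing bijections of `ℝ` is a smooth family. -/
theorem contDiff_inverse_family {E : Type*} [NormedAddCommGroup E] [NormedSpace ℝ E]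
    [CompleteSpace E] {G H : E × ℝ → ℝ} (hG : ContDiff ℝ ∞ G)
    (hpos : ∀ u x, deriv (fun x => G (u, x)) x ≠ 0) (hGH : ∀ u y, G (u, H (u, y)) = y)
    (hHG : ∀ u x, H (u, G (u, x)) = x) : ContDiff ℝ ∞ H := by
  rw [contDiff_iff_contDiffAt]
  rintro ⟨u, y⟩
  set a : E × ℝ := (u, H (u, y)) with ha
  set Φ : E × ℝ → E × ℝ := fun z => (z.1, G z) with hΦ
  have hΦs : ContDiffAt ℝ ∞ Φ a := (contDiff_fst.prodMk hG).contDiffAt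
  have hGd : HasFDerivAt G (fderiv ℝ G a) a := (hG.differentiable (by simp) a).hasFDerivAt
  set L := fderiv ℝ G a
  have hc : L (0, 1) ≠ 0 := by
    have h1 : HasDerivAt (fun x => G (u, x)) (L (0, 1)) (H (u, y)) :=
      HasFDerivAt.comp_hasDerivAt (f := fun x : ℝ => (u, x)) (H (u, y)) hGd
        ((hasDerivAt_const _ u).prodMk (hasDerivAt_id' _))
    rw [← h1.deriv]
    exact hpos u _
  have hL : ∀ v s, L (v, s) = L (v, 0) + s * L (0, 1) := fun v s => by
    rw [← smul_eq_mul, ← L.map_smul, ← L.map_add]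
    simp
  -- The derivative of `(u, x) ↦ (u, G(u, x))` is triangular with nonzero corner `∂ₓG = L (0, 1)`,
  -- so the inverse function theorem applies.
  let e : (E × ℝ) ≃L[ℝ] (E × ℝ) := ContinuousLinearEquiv.equivOfInverse
    ((ContinuousLinearMap.fst ℝ E ℝ).prod L)
    ((ContinuousLinearMap.fst ℝ E ℝ).prod ((L (0, 1))⁻¹ • (ContinuousLinearMap.snd ℝ E ℝ -
      L.comp ((ContinuousLinearMap.inl ℝ E ℝ).comp (ContinuousLinearMap.fst ℝ E ℝ)))))
    (fun ⟨v, s⟩ => by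
      refine Prod.ext rfl ?_
      simp [hL v s]
      field_simp)
    (fun ⟨v, s⟩ => by
      refine Prod.ext rfl ?_
      simp [hL v ((L (0, 1))⁻¹ * _)]
      field_simp
      ring)
  have he : HasFDerivAt Φ (e : E × ℝ →L[ℝ] E × ℝ) a := (hasFDerivAt_fst).prodMk hGd
  have hΦa : Φ a = (u, y) := Prod.ext rfl (hGH u y)
  have hinv := hΦs.to_localInverse he (by simp)
  have hright := (hΦs.hasStrictFDerivAt' he (by simp)).eventually_right_inverse
  rw [hΦa] at hinv hright
  refine hinv.snd.congr_of_eventuallyEq ?_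
  filter_upwards [hright] with z hz
  have h1 := congrArg Prod.fst hz
  have h2 := congrArg Prod.snd hz
  simp only [hΦ] at h1 h2
  -- By `hHG`, the second component of the local inverse must agree with `H`.
  rw [← Prod.mk.eta (p := z), ← h1, ← h2]
  refine (hHG _ _).trans ?_
  rw [h1, h2]
  rfl

/-- The derivative in the last variable of a smooth function is smooth. -/
theorem ContDiff.deriv_right {E : Type*} [NormedAddCommGroup E] [NormedSpace ℝ E]
    {G : E × ℝ → ℝ} (hG : ContDiff ℝ ∞ G) :
    ContDiff ℝ ∞ fun z : E × ℝ => deriv (fun x => G (z.1, x)) z.2 := by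
  have e : (fun z : E × ℝ => deriv (fun x => G (z.1, x)) z.2) = fun z => fderiv ℝ G z (0, 1) := by
    funext z
    exact (HasFDerivAt.comp_hasDerivAt (f := fun x : ℝ => (z.1, x)) z.2
      (hG.differentiable (by simp) z).hasFDerivAt
        ((hasDerivAt_const _ z.1).prodMk (hasDerivAt_id' _))).deriv
  rw [e]
  exact (hG.fderiv_right (m := ∞) (by simp)).clm_apply contDiff_const

namespace SmoothPer.SmoothFamily

variable {n : ℕ} {f g : (Fin n → ℝ) → SmoothPer}

theorem D (hf : SmoothFamily f) : SmoothFamily fun u => (f u).D :=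
  ContDiff.deriv_right hf

theorem add (hf : SmoothFamily f) (hg : SmoothFamily g) : SmoothFamily fun u => f u + g u :=
  ContDiff.add hf hg

theorem sub (hf : SmoothFamily f) (hg : SmoothFamily g) : SmoothFamily fun u => f u - g u :=
  ContDiff.sub hf hg

theorem neg (hf : SmoothFamily f) : SmoothFamily fun u => -f u :=
  ContDiff.neg hf

theorem mul (hf : SmoothFamily f) (hg : SmoothFamily g) : SmoothFamily fun u => f u * g u :=
  ContDiff.mul hf hg

theorem pow (hf : SmoothFamily f) (k : ℕ) : SmoothFamily fun u => f u ^ k :=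
  ContDiff.pow hf k

theorem smul {c : (Fin n → ℝ) → ℝ} (hc : ContDiff ℝ ∞ c) (hf : SmoothFamily f) :
    SmoothFamily fun u => c u • f u :=
  ContDiff.mul (hc.comp contDiff_fst) hf

theorem integral (hf : SmoothFamily f) : ContDiff ℝ ∞ fun u => (f u).integral :=
  contDiff_infty.2 fun k => ContDiff.intervalIntegral_right (hf.of_le (by exact_mod_cast le_top)) 0 1

end SmoothPer.SmoothFamily

namespace DiffCircle.SmoothFamily

variable {n : ℕ} {p : (Fin n → ℝ) → DiffCircle}

theorem der (hp : SmoothFamily p) : SmoothPer.SmoothFamily fun u => (p u).der := by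
  obtain ⟨G, hG, hl⟩ := hp
  have e : (fun z : (Fin n → ℝ) × ℝ => (p z.1).der z.2) = fun z => deriv (G z.1) z.2 :=
    funext fun z => (hl z.1).der_apply z.2
  rw [SmoothPer.SmoothFamily, e]
  exact ContDiff.deriv_right hG

theorem derInv (hp : SmoothFamily p) : SmoothPer.SmoothFamily fun u => (p u).derInv :=
  ContDiff.inv hp.der fun z => ((p z.1).der_pos z.2).ne'

theorem schwarzian (hp : SmoothFamily p) : SmoothPer.SmoothFamily fun u => (p u).schwarzian :=
  (hp.der.D.D.mul hp.derInv).sub ((hp.der.D.mul hp.derInv).pow 2 |>.smul contDiff_const)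

/-- Needed because `Ψ` sends the class of `F` to `F⁻¹ · L(ℓ)`, while smoothness on the orbit is
tested with `F · L(ℓ)`. -/
theorem inv (hp : SmoothFamily p) : SmoothFamily fun u => (p u)⁻¹ := by
  obtain ⟨G, hG, hl⟩ := hp
  refine ⟨fun u => (hl u).1.homeo.symm, ?_, fun u => ⟨(hl u).1.symm, fun x => ?_⟩⟩
  · exact contDiff_inverse_family (G := fun z => G z.1 z.2)
      (H := fun z => (hl z.1).1.homeo.symm z.2) hG (fun u x => ((hl u).1.deriv_pos x).ne')
      (fun u y => (hl u).1.homeo.apply_symm_apply y)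
      (fun u x => (hl u).1.homeo.symm_apply_apply x)
  · change (p u).1⁻¹ _ = _
    rw [Equiv.Perm.inv_eq_iff_eq, (hl u).2, ← (hl u).1.homeo_apply,
      (hl u).1.homeo.apply_symm_apply]

end DiffCircle.SmoothFamily

/-! ### The symplectic and Hamiltonian structures on `N`. -/

namespace Trumpet

theorem isOneForm_potentialForm : IsOneForm potentialForm where
  linear m :=
    { map_add := fun v w => by
        rw [potentialForm, potentialForm, potentialForm, ← SmoothPer.integral_add]
        congr 1
        apply SmoothPer.ext'
        intro x
        simp
        ring
      map_smul := fun c v => by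
        rw [potentialForm, potentialForm, smul_eq_mul, ← SmoothPer.integral_smul]
        congr 1
        apply SmoothPer.ext'
        intro x
        simp
        ring }
  smooth n p v hp hv :=
    (((hp.2.der.mul hv.2).smul (hp.1.pow 2)).add (hp.2.derInv.mul hv.2.D.D)).integral

theorem isTwoForm_omega : IsTwoForm omega where
  linear_left m w := ⟨fun u v => omega_add_left m u v w, fun c v => omega_smul_left m c v w⟩
  linear_right m v :=
    ⟨fun u w => by rw [omega_swap, omega_add_left, omega_swap m u, omega_swap m w]; ring,
      fun c w => by rw [omega_swap, omega_smul_left, omega_swap m w, smul_eq_mul]; ring⟩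
  alternating := omega_self
  smooth n p v w hp hv hw := by
    simp only [omega_eq, omegaDensity]
    exact (((hp.2.der.mul ((hv.2.smul hw.1).sub (hw.2.smul hv.1))).smul (hp.1.div_const 2)).sub
      (((hv.2.D.mul hw.2).sub (hw.2.D.mul hv.2)).smul ((hp.1.pow 2).div_const 4))).add
      ((((hv.2.D.mul hw.2.D.D).sub (hw.2.D.mul hv.2.D.D)).mul (hp.2.derInv.pow 2)).smul
        contDiff_const) |>.integral

theorem isSymplectic_omega : IsSymplectic omega :=
  ⟨isTwoForm_omega, omega_closed, omega_nondegenerate⟩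

theorem isDiffHamiltonian_omega : IsDiffHamiltonian omega diffMoment (-1) where
  symplectic := isSymplectic_omega
  invariant := omega_smul
  momentMap :=
    { level := fun _ => rfl
      smooth := fun n p hp => by
        simp only [diffMoment, coadInv_hillPotential]
        exact (((hp.2.der.pow 2).smul ((hp.1.pow 2).neg.div_const 4)).add
          (hp.2.schwarzian.smul contDiff_const)).neg
      equivariant := coad_diffMoment
      moment := hasDerivAt_diffMoment }

theorem isCircleHamiltonian_omega : IsCircleHamiltonian omega circleMoment where
  symplectic := isSymplectic_omega
  invariant := omega_vadd
  smooth _ _ hp := (hp.1.pow 2).div_const 4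
  moment_invariant _ _ := rfl
  moment m w := by
    rw [omega_circleGenerator, neg_neg]
    exact hasDerivAt_circleMoment m w

end Trumpet

/-! ### Reduction by `S¹` and the identification with the coadjoint orbit. -/

theorem coadInv_mem_coadOrbit (F : DiffCircle) (μ : VirDual) : coadInv F μ ∈ coadOrbit μ :=
  ⟨F⁻¹, by change coadInv F⁻¹⁻¹ μ = _; rw [inv_inv]⟩

namespace Trumpet

theorem LevelSet.len_eq {ℓ : ℝ} (hℓ : 0 < ℓ) (m : LevelSet (ℓ ^ 2 / 4)) : m.1.len = ℓ := by
  have h : m.1.len ^ 2 / 4 = ℓ ^ 2 / 4 := m.2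
  exact (sq_eq_sq₀ m.1.len_pos.le hℓ.le).1 (by linarith)

theorem der_eq_of_toReduced_eq {c : ℝ} {m m' : LevelSet c} (h : toReduced m = toReduced m') :
    m.1.twist.der = m'.1.twist.der := by
  obtain ⟨t, rfl⟩ : m ∈ AddAction.orbit UnitAddCircle m' := Quotient.exact h
  exact der_rotation_mul t m'.1.twist

theorem toReduced_out {c : ℝ} (q : Reduced c) : toReduced (Quotient.out q) = q :=
  Quotient.out_eq q

theorem toReduced_eq_of_rotation {ℓ : ℝ} (hℓ : 0 < ℓ) {m m' : LevelSet (ℓ ^ 2 / 4)}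
    {t : UnitAddCircle} (h : rotation t * m'.1.twist = m.1.twist) :
    toReduced m = toReduced m' := by
  refine Quotient.sound ⟨t, Subtype.ext (Trumpet.ext ?_ h)⟩
  change m'.1.len = m.1.len
  rw [m.len_eq hℓ, m'.len_eq hℓ]

theorem mk_eq_mk_iff {h k : SmoothPer} :
    (Submodule.Quotient.mk h : ReducedTangent) = Submodule.Quotient.mk k ↔
      ∃ c : ℝ, h = k + c • (1 : SmoothPer) := by
  rw [Submodule.Quotient.eq, Submodule.mem_span_singleton]
  exact exists_congr fun c => ⟨fun e => by rw [e]; abel, fun e => by rw [e]; abel⟩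

/-- The restriction of `ω_N` to level sets of `ℓ` does not change under constant variations. -/
theorem omega_add_const_left (m : Trumpet) (h k : SmoothPer) (c : ℝ) :
    omega m (0, h + c • (1 : SmoothPer)) (0, k) = omega m (0, h) (0, k) := by
  -- Constants are multiples of the circle generator `(0, -1)`, whose contraction with `ω_N` sees
  -- only `dℓ`.
  have e : ((0, h + c • (1 : SmoothPer)) : TrumpetTangent) = (0, h) + (-c) • circleGenerator := by
    refine Prod.ext (by simp [circleGenerator]) (SmoothPer.ext' fun x => ?_)
    simp [circleGenerator]
  rw [e, omega_add_left, omega_smul_left, omega_circleGenerator]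
  simp

theorem omega_congr_tangent {m m' : Trumpet} (h1 : m.len = m'.len)
    (h2 : m.twist.der = m'.twist.der) {h h' k k' : SmoothPer}
    (eh : (Submodule.Quotient.mk h : ReducedTangent) = Submodule.Quotient.mk h')
    (ek : (Submodule.Quotient.mk k : ReducedTangent) = Submodule.Quotient.mk k') :
    omega m (0, h) (0, k) = omega m' (0, h') (0, k') := by
  obtain ⟨c, rfl⟩ := mk_eq_mk_iff.1 eh
  obtain ⟨d, rfl⟩ := mk_eq_mk_iff.1 ek
  rw [omega_add_const_left, omega_swap, omega_add_const_left, omega_swap, neg_neg]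
  exact omega_eq_of_der_eq h1 h2 _ _

/-- The reduced form on `N_red`, computed with representatives. -/
noncomputable def reducedOmega {c : ℝ} (q : Reduced c) (v w : ReducedTangent) : ℝ :=
  omega (Quotient.out q).1 (0, Quotient.out v) (0, Quotient.out w)

theorem mk_out (v : ReducedTangent) :
    (Submodule.Quotient.mk (Quotient.out v) : ReducedTangent) = v :=
  Quotient.out_eq v

theorem reducedOmega_mk {ℓ : ℝ} (hℓ : 0 < ℓ) (m : LevelSet (ℓ ^ 2 / 4)) (h k : SmoothPer) :
    reducedOmega (toReduced m) (Submodule.Quotient.mk h) (Submodule.Quotient.mk k)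
      = omega m.1 (0, h) (0, k) :=
  omega_congr_tangent ((LevelSet.len_eq hℓ _).trans (m.len_eq hℓ).symm)
    (der_eq_of_toReduced_eq (toReduced_out _)) (mk_out _) (mk_out _)

theorem isReducedForm_reducedOmega {ℓ : ℝ} (hℓ : 0 < ℓ) :
    IsReducedForm omega (ℓ ^ 2 / 4) reducedOmega := by
  intro m v w hv hw
  rw [dirDeriv, (hasDerivAt_circleMoment _ _).deriv] at hv hw
  have hl := m.1.len_pos.ne'
  have hv1 : v.1 = 0 := by simpa [hl] using hv
  have hw1 : w.1 = 0 := by simpa [hl] using hw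
  have ev : v = (0, v.2) := Prod.ext hv1 rfl
  have ew : w = (0, w.2) := Prod.ext hw1 rfl
  rw [toReducedTangent, toReducedTangent, reducedOmega_mk hℓ, ← ev, ← ew]

theorem reducedOmega_nondegenerate {ℓ : ℝ} (hℓ : 0 < ℓ) (q : Reduced (ℓ ^ 2 / 4))
    (v : ReducedTangent) (h0 : ∀ w, reducedOmega q v w = 0) : v = 0 := by
  obtain ⟨m, rfl⟩ : ∃ m, toReduced m = q := ⟨_, toReduced_out q⟩
  obtain ⟨h, rfl⟩ := Submodule.Quotient.mk_surjective _ v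
  have hD := D_eq_zero_of_omega_eq_zero m.1 h fun k => by rw [← reducedOmega_mk hℓ, h0]
  rw [← Submodule.Quotient.mk_zero, mk_eq_mk_iff]
  exact ⟨h 0, by rw [zero_add]; exact SmoothPer.eq_const_of_D_eq_zero hD⟩

/-- The map `[(ℓ, F)] ↦ F⁻¹ · L(ℓ)` from the reduced space to the coadjoint orbit. -/
noncomputable def reducedToOrbit (ℓ : ℝ) (q : Reduced (ℓ ^ 2 / 4)) :
    coadOrbit (hill (hillPotential ℓ)) :=
  ⟨coadInv (Quotient.out q).1.twist (hill (hillPotential ℓ)), coadInv_mem_coadOrbit _ _⟩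

theorem reducedToOrbit_toReduced (ℓ : ℝ) (m : LevelSet (ℓ ^ 2 / 4)) :
    (reducedToOrbit ℓ (toReduced m) : VirDual) =
      coadInv m.1.twist (hill (hillPotential ℓ)) :=
  coadInv_eq_of_der_eq (der_eq_of_toReduced_eq (toReduced_out _)) ℓ

/-- The point of the level set of `ℓ` with a given twist. -/
def levelPoint {ℓ : ℝ} (hℓ : 0 < ℓ) (F : DiffCircle) : LevelSet (ℓ ^ 2 / 4) :=
  ⟨⟨ℓ, hℓ, F⟩, rfl⟩

theorem reducedToOrbit_bijective {ℓ : ℝ} (hℓ : 0 < ℓ) :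
    Function.Bijective (reducedToOrbit ℓ) := by
  refine ⟨fun q q' h => ?_, fun ⟨μ, F, hF⟩ => ?_⟩
  · obtain ⟨t, ht⟩ := exists_rotation_of_coadInv_hill_eq hℓ (congrArg Subtype.val h)
    rw [← toReduced_out q, ← toReduced_out q']
    exact toReduced_eq_of_rotation hℓ ht
  · refine ⟨toReduced (levelPoint hℓ F⁻¹), Subtype.ext ?_⟩
    rw [reducedToOrbit_toReduced]
    exact hF

theorem reducedToOrbit_smul (ℓ : ℝ) (F : DiffCircle) (m : LevelSet (ℓ ^ 2 / 4)) :
    (reducedToOrbit ℓ (toReduced (F • m)) : VirDual) =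
      coad F (reducedToOrbit ℓ (toReduced m)) := by
  rw [reducedToOrbit_toReduced, reducedToOrbit_toReduced, coad, ← coadInv_mul]
  rfl

/-- Inverting the twist exchanges local lifts to the level set with local lifts to the group. -/
theorem reducedSmooth_iff_orbitSmooth {ℓ : ℝ} (hℓ : 0 < ℓ) {n : ℕ}
    (p : (Fin n → ℝ) → Reduced (ℓ ^ 2 / 4)) :
    ReducedSmooth p ↔ OrbitSmooth (hill (hillPotential ℓ)) fun u => reducedToOrbit ℓ (p u) := by
  refine forall_congr' fun u => ⟨?_, ?_⟩
  · rintro ⟨q, hq, h⟩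
    refine ⟨fun v => (q v).1.twist⁻¹, hq.2.inv, h.mono fun v hv => ?_⟩
    change (reducedToOrbit ℓ (p v) : VirDual) = coadInv (q v).1.twist⁻¹⁻¹ _
    rw [hv, reducedToOrbit_toReduced, inv_inv]
  · rintro ⟨F, hF, h⟩
    refine ⟨fun v => levelPoint hℓ (F v)⁻¹, ⟨contDiff_const, hF.inv⟩, h.mono fun v hv => ?_⟩
    refine (reducedToOrbit_bijective hℓ).1 (Subtype.ext ?_)
    rw [hv, reducedToOrbit_toReduced]
    rfl

/-- The tangent map of `reducedToOrbit`. -/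
noncomputable def reducedToOrbitTangent (ℓ : ℝ) (q : Reduced (ℓ ^ 2 / 4)) :
    ReducedTangent →ₗ[ℝ] SmoothPer :=
  Submodule.liftQ _ (hillVariation ℓ (Quotient.out q).1.twist) (by
    rw [Submodule.span_le, Set.singleton_subset_iff]
    exact hillVariation_one ℓ _)

theorem reducedToOrbitTangent_mk (ℓ : ℝ) (m : LevelSet (ℓ ^ 2 / 4)) (h : SmoothPer) :
    reducedToOrbitTangent ℓ (toReduced m) (Submodule.Quotient.mk h)
      = hillVariation ℓ m.1.twist h := by
  rw [← hillVariation_eq_of_der_eq (der_eq_of_toReduced_eq (toReduced_out (toReduced m)))]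
  rfl

/-- The moment map identity at fixed `ℓ`. It yields both the injectivity of the tangent maps and the
comparison with the KKS form. -/
theorem omega_generator_vertical (m : Trumpet) (f h : SmoothPer) :
    omega m (0, -(m.twist.der * f)) (0, h) = (hillVariation m.len m.twist h * f).integral := by
  have e := integral_momentVariation m f (0, h)
  rw [diffGenerator] at e
  simp only [mul_zero, zero_div, zero_smul, SmoothPer.integral_sub, SmoothPer.integral_zero] at e
  linarith

/-- Every variation is generated by some `f`, so by `omega_generator_vertical` a vector with zero
image pairs to zero with everything in the nondegenerate reduced form. -/
theorem reducedToOrbitTangent_injective {ℓ : ℝ} (hℓ : 0 < ℓ) (q : Reduced (ℓ ^ 2 / 4)) :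
    Function.Injective (reducedToOrbitTangent ℓ q) := by
  rw [injective_iff_map_eq_zero]
  intro v hv
  obtain ⟨m, rfl⟩ : ∃ m, toReduced m = q := ⟨_, toReduced_out q⟩
  obtain ⟨h, rfl⟩ := Submodule.Quotient.mk_surjective _ v
  refine reducedOmega_nondegenerate hℓ (toReduced m) _ fun w => ?_
  obtain ⟨k, rfl⟩ := Submodule.Quotient.mk_surjective _ w
  rw [reducedToOrbitTangent_mk] at hv
  rw [reducedOmega_mk hℓ, omega_swap, ← neg_der_mul_neg_derInv_mul m.1.twist k,
    omega_generator_vertical, m.len_eq hℓ, hv, zero_mul, SmoothPer.integral_zero, neg_zero]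

theorem reducedToOrbitTangent_generator (ℓ : ℝ) (m : LevelSet (ℓ ^ 2 / 4)) (f : SmoothPer) :
    reducedToOrbitTangent ℓ (toReduced m) (Submodule.Quotient.mk (-(m.1.twist.der * f)))
      = coadGenerator f (reducedToOrbit ℓ (toReduced m)) := by
  rw [reducedToOrbitTangent_mk, reducedToOrbit_toReduced, hillVariation_generator]

theorem reducedToOrbitTangent_bijOn {ℓ : ℝ} (hℓ : 0 < ℓ) (q : Reduced (ℓ ^ 2 / 4)) :
    Set.BijOn (reducedToOrbitTangent ℓ q) Set.univ (orbitTangent (reducedToOrbit ℓ q)) := by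
  obtain ⟨m, rfl⟩ : ∃ m, toReduced m = q := ⟨_, toReduced_out q⟩
  refine ⟨fun v _ => ?_, (reducedToOrbitTangent_injective hℓ _).injOn, ?_⟩
  · obtain ⟨h, rfl⟩ := Submodule.Quotient.mk_surjective _ v
    refine ⟨-(m.1.twist.derInv * h), ?_⟩
    change coadGenerator _ _ = _
    rw [← reducedToOrbitTangent_generator, neg_der_mul_neg_derInv_mul]
  · rintro _ ⟨f, rfl⟩
    exact ⟨_, trivial, reducedToOrbitTangent_generator ℓ m f⟩

/-- By injectivity, `v` and `w` are the classes of `-F'f` and `-F'g`. The reduced form is then `∫ f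
· coadGenerator g`, which `kks_eq` evaluates. -/
theorem reducedOmega_eq_neg_kks {ℓ : ℝ} (hℓ : 0 < ℓ) (q : Reduced (ℓ ^ 2 / 4))
    (v w : ReducedTangent) (f g : SmoothPer)
    (hv : reducedToOrbitTangent ℓ q v = coadGenerator f (reducedToOrbit ℓ q))
    (hw : reducedToOrbitTangent ℓ q w = coadGenerator g (reducedToOrbit ℓ q)) :
    reducedOmega q v w = -kks (reducedToOrbit ℓ q) f g := by
  obtain ⟨m, rfl⟩ : ∃ m, toReduced m = q := ⟨_, toReduced_out q⟩
  rw [← reducedToOrbitTangent_generator] at hv hw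
  rw [reducedToOrbitTangent_injective hℓ _ hv, reducedToOrbitTangent_injective hℓ _ hw,
    reducedOmega_mk hℓ, omega_generator_vertical, m.len_eq hℓ, hillVariation_generator,
    reducedToOrbit_toReduced]
  exact kks_eq f g _

end Trumpet

theorem theorem8p1 :
    Trumpet.IsOneForm Trumpet.potentialForm ∧
    Trumpet.IsDiffHamiltonian Trumpet.omega Trumpet.diffMoment (-1) ∧
    (∀ Ω, Trumpet.IsDiffHamiltonian Ω Trumpet.diffMoment (-1) → Ω = Trumpet.omega) ∧
    Trumpet.IsCircleHamiltonian Trumpet.omega Trumpet.circleMoment ∧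
    ∀ ℓ : ℝ, 0 < ℓ →
      ∃ Ωred : Trumpet.Reduced (ℓ ^ 2 / 4) →
          Trumpet.ReducedTangent → Trumpet.ReducedTangent → ℝ,
        Trumpet.IsReducedForm Trumpet.omega (ℓ ^ 2 / 4) Ωred ∧
        (∀ q v, (∀ w, Ωred q v w = 0) → v = 0) ∧
        ∃ Ψ : Trumpet.Reduced (ℓ ^ 2 / 4) ≃ coadOrbit (hill (Trumpet.hillPotential ℓ)),
          (∀ m : Trumpet.LevelSet (ℓ ^ 2 / 4),
            (Ψ (Trumpet.toReduced m) : VirDual) =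
              coadInv m.1.twist (hill (Trumpet.hillPotential ℓ))) ∧
          (∀ (F : DiffCircle) (m : Trumpet.LevelSet (ℓ ^ 2 / 4)),
            (Ψ (Trumpet.toReduced (F • m)) : VirDual) = coad F (Ψ (Trumpet.toReduced m))) ∧
          (∀ (n : ℕ) (p : (Fin n → ℝ) → Trumpet.Reduced (ℓ ^ 2 / 4)),
            Trumpet.ReducedSmooth p ↔
              OrbitSmooth (hill (Trumpet.hillPotential ℓ)) fun u => Ψ (p u)) ∧
          ∃ dΨ : Trumpet.Reduced (ℓ ^ 2 / 4) → Trumpet.ReducedTangent →ₗ[ℝ] SmoothPer,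
            (∀ (m : Trumpet.LevelSet (ℓ ^ 2 / 4)) (h : SmoothPer) (x : ℝ),
              HasDerivAt
                (fun t => (coadInv (m.1.translate (0, h) t).twist
                  (hill (Trumpet.hillPotential ℓ))).1 x)
                (dΨ (Trumpet.toReduced m) (Trumpet.toReducedTangent (0, h)) x) 0) ∧
            (∀ q, Set.BijOn (dΨ q) Set.univ (orbitTangent (Ψ q))) ∧
            (∀ q v w f g, dΨ q v = coadGenerator f (Ψ q) → dΨ q w = coadGenerator g (Ψ q) →
              Ωred q v w = -kks (Ψ q) f g) := by
  refine ⟨Trumpet.isOneForm_potentialForm, Trumpet.isDiffHamiltonian_omega,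
    Trumpet.eq_omega_of_isDiffHamiltonian, Trumpet.isCircleHamiltonian_omega, fun ℓ hℓ => ?_⟩
  refine ⟨Trumpet.reducedOmega, Trumpet.isReducedForm_reducedOmega hℓ,
    Trumpet.reducedOmega_nondegenerate hℓ,
    Equiv.ofBijective _ (Trumpet.reducedToOrbit_bijective hℓ),
    Trumpet.reducedToOrbit_toReduced ℓ, Trumpet.reducedToOrbit_smul ℓ,
    fun n p => Trumpet.reducedSmooth_iff_orbitSmooth hℓ p,
    Trumpet.reducedToOrbitTangent ℓ, fun m h x => ?_, Trumpet.reducedToOrbitTangent_bijOn hℓ,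
    Trumpet.reducedOmega_eq_neg_kks hℓ⟩
  have e := Trumpet.hasDerivAt_coadInv_translate m.1 h x
  rw [m.len_eq hℓ] at e
  rw [Trumpet.toReducedTangent, Trumpet.reducedToOrbitTangent_mk]
  exact e
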